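/- Let $r\ge 3$ and $\mathfrak g=\mathfrak{sp}(2r)$, with simple roots $\alpha_1,\dots,\alpha_r$, coroots $\alpha_i^\vee$, fundamental weights $\omega_1,\dots,\omega_r$, and invariant form normalized by $(\alpha_i,\alpha_i)=2$ for $i<r$ and $(\alpha_r,\alpha_r)=4$. Let $\lambda$ be a dominant integral weight and $\lambda_i=\langle\lambda,\alpha_i^\vee\rangle$. Let $\boldsymbol l=(l_1,\dots,l_r)$ be of the form $$(\underbrace{1,\dots,1}_{k_1},0,\dots,0),\ 0\le k_1\le r,\qquad\text{or}\qquad(\underbrace{1,\dots,1}_{k_2},2,\dots,2,1),\ 0\le k_2\le r-2,$$ and put $l=l_1+\dots+l_r\in\{0,\dots,2r-1\}$ (which determines $\boldsymbol l$) and $\alpha(\boldsymbol l)=\sum_i l_i\alpha_i$. Call $\boldsymbol l$ admissible if $V_{\lambda+\omega_1-\alpha(\boldsymbol l)}$ appears in the decomposition of $V_\lambda\otimes V_{\omega_1}$ as the direct sum of the $V_{\lambda+\omega_1-\alpha(\boldsymbol l')}$ over all $\boldsymbol l'$ of the above form, where summands with non-dominant highest weight are omitted; that is, if $\lambda+\omega_1-\alpha(\boldsymbol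 l)$ is dominant. Consider complex variables $t_1,\dots,t_l$, of which $l_i$ have color $i$ for each $i$; let $c(j)$ be the color of $t_j$. The Bethe ansatz equation associated to $\boldsymbol\Lambda=(\Lambda_1,\Lambda_2)=(\lambda,\omega_1)$, $\boldsymbol z=(z_1,z_2)=(0,1)$ and $\boldsymbol l$ is the system $$-\sum_{s=1}^{2}\frac{(\alpha_{c(i)},\Lambda_s)}{t_i-z_s}+\sum_{j\ne i}\frac{(\alpha_{c(i)},\alpha_{c(j)})}{t_i-t_j}=0,\qquad i=1,\dots,l,$$ where terms with zero numerator are absent and the other denominators have to be nonzero. Solutions that differ by a permutation of variables of the same color are identified. A solution is represented by the polynomials $y_i(x)=\prod_{j:\,c(j)=i}(x-t_j)$, $i=1,\dots,r$. Then: if $\boldsymbol l$ is not admissible, the Bethe ansatz equation has no solutions. If $\boldsymbol l$ is admissible, it has exactly one solution, and this solution is represented by the following $r$-tuple $\boldsymbol y^{(l)}$. (1) For $0\le l\le r-1$: $\boldsymbol y^{(l)}=(x-c_1,\dots,x-c_l,1,\dots,1)$ with $$c_j=\prod_{i=1}^{j}\frac{\lambda_i+\dots+\lambda_l+l-i}{\lambda_i+\dots+\lambda_l+l-i+1},\qquad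 j=1,\dots,l.$$ (2) For $l=r$: $\boldsymbol y^{(r)}=(x-c_1,\dots,x-c_r)$ with $$c_j=\prod_{i=1}^{j}\frac{\lambda_i+\dots+\lambda_{r-1}+2\lambda_r+r+1-i}{\lambda_i+\dots+\lambda_{r-1}+2\lambda_r+r+2-i}\quad(j=1,\dots,r-1),\qquad c_r=\frac{\lambda_r}{\lambda_r+1}\,c_{r-1}.$$ (3) For $r+1\le l\le 2r-1$, put $m=2r-l$ and $$P_j=\prod_{i=1}^{j}\frac{\lambda_i+\dots+\lambda_{m-1}+2\lambda_{m}+\dots+2\lambda_r+l+1-i}{\lambda_i+\dots+\lambda_{m-1}+2\lambda_{m}+\dots+2\lambda_r+l+2-i},$$ $$Q_{a,b}=\prod_{i=a}^{b}\frac{\lambda_{m}+\dots+\lambda_i+2\lambda_{i+1}+\dots+2\lambda_r+l-i}{\lambda_{m}+\dots+\lambda_i+2\lambda_{i+1}+\dots+2\lambda_r+l-i+1},\qquad S=2\lambda_m+\dots+2\lambda_r,$$ empty products being $1$. Then $$\boldsymbol y^{(l)}=(x-c_1,\dots,x-c_{m-1},(x-a_m)(x-b_m),\dots,(x-a_{r-1})(x-b_{r-1}),x-c_r),$$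 where $c_j=P_j$ for $j=1,\dots,m-1$, $c_r=P_{m-1}Q_{m,r}$, and for $k=m,\dots,r-1$ $$a_kb_k=P_{m-1}^2\,Q_{m,k-1}\,Q_{m,r}\prod_{i=1}^{r+1-k}\frac{\lambda_{m}+\dots+\lambda_{r+1-i}+l+1-i-r}{\lambda_{m}+\dots+\lambda_{r+1-i}+l+2-i-r},$$ $$a_k+b_k=P_{m-1}\,Q_{m,k-1}\left(\frac{S+2l-2r}{S+2l+1-2r}+\frac{S+2l+2-2r}{S+2l+1-2r}\;Q_{k,r}\prod_{i=k}^{r}\frac{\lambda_{m}+\dots+\lambda_{i}+l+i-2r}{\lambda_{m}+\dots+\lambda_{i}+l+i+1-2r}\right).$$ -/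

import Mathlib

open scoped Polynomial

namespace Gaudin

/-!
Weights are given by their coordinates `μ i = ⟨μ, αᵢ^∨⟩` in the basis of fundamental weights.
Indices `i : Fin r` are zero-based, so `i` stands for the simple root `α_{i+1}`.
-/

noncomputable section

/-! ### Bethe ansatz equations for a Cartan matrix `A` with symmetrizer `d`

Conventions: `A i j = ⟨αⱼ, αᵢ^∨⟩`, and `diag(d) * A` is symmetric. -/

section General

/-- The scalar product `(αᵢ, αⱼ) = dᵢ aᵢⱼ` of two simple roots. -/
def rootPairing {r : ℕ} (A : Matrix (Fin r) (Fin r) ℤ) (d : Fin r → ℤ) (i j : Fin r) : ℂ :=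
  ((d i * A i j : ℤ) : ℂ)

/-- The scalar product `(αᵢ, μ) = dᵢ ⟨μ, αᵢ^∨⟩` of a simple root and a weight. -/
def weightPairing {r : ℕ} (d : Fin r → ℤ) (i : Fin r) (μ : Fin r → ℂ) : ℂ :=
  (d i : ℂ) * μ i

/-- The weight `α(l) = ∑ⱼ lⱼ αⱼ`. -/
def rootCombination {r : ℕ} (A : Matrix (Fin r) (Fin r) ℤ) (l : Fin r → ℕ) : Fin r → ℂ :=
  fun i => ∑ j, (l j : ℂ) * (A i j : ℂ)

/-- Dominant integral weights. -/
def IsDominantIntegral {r : ℕ} (μ : Fin r → ℂ) : Prop :=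
  ∀ i, ∃ m : ℕ, μ i = (m : ℂ)

/-- The variables of the Bethe ansatz equation: `l i` variables of color `i`. -/
abbrev Var {r : ℕ} (l : Fin r → ℕ) : Type := (i : Fin r) × Fin (l i)

/-- `t` is a solution of the Bethe ansatz equation associated to the weights `Λ`, the points `z`
and `l`. The first two conditions say that every fraction with a nonzero numerator has a nonzero
denominator; the terms with zero numerator are absent. -/
def IsBetheSolution {r n : ℕ} (A : Matrix (Fin r) (Fin r) ℤ) (d : Fin r → ℤ)
    (Λ : Fin n → Fin r → ℂ) (z : Fin n → ℂ) (l : Fin r → ℕ) (t : Var l → ℂ) : Prop :=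
  (∀ p s, weightPairing d p.1 (Λ s) ≠ 0 → t p ≠ z s) ∧
  (∀ p q, p ≠ q → rootPairing A d p.1 q.1 ≠ 0 → t p ≠ t q) ∧
  ∀ p, -(∑ s, weightPairing d p.1 (Λ s) / (t p - z s)) +
      ∑ q ∈ Finset.univ.erase p, rootPairing A d p.1 q.1 / (t p - t q) = 0

/-- `t` and `t'` differ by a permutation of the variables which preserves colors. -/
def SameOrbit {r : ℕ} {l : Fin r → ℕ} (t t' : Var l → ℂ) : Prop :=
  ∃ σ : Equiv.Perm (Var l), (∀ p, (σ p).1 = p.1) ∧ ∀ p, t' p = t (σ p)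

/-- The `r`-tuple of polynomials representing `t`. -/
def representingTuple {r : ℕ} {l : Fin r → ℕ} (t : Var l → ℂ) (i : Fin r) : ℂ[X] :=
  ∏ j : Fin (l i), (Polynomial.X - Polynomial.C (t ⟨i, j⟩))

end General

/-! ### The symplectic Lie algebra `sp(2r)` -/

section TypeC

/-- The Cartan matrix `aᵢⱼ = ⟨αⱼ, αᵢ^∨⟩` of `sp(2r)`; Mathlib's `CartanMatrix.C` follows Bourbaki's
convention `⟨αᵢ, αⱼ^∨⟩`, hence the transpose. -/
def cartanC (r : ℕ) : Matrix (Fin r) (Fin r) ℤ := (CartanMatrix.C r).transpose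

/-- The symmetrizer `d = (1, …, 1, 2)`, so that `(αᵢ, αᵢ) = 2` for `i < r` and `(αᵣ, αᵣ) = 4`. -/
def symmetrizerC (r : ℕ) (i : Fin r) : ℤ := if i.val + 1 = r then 2 else 1

theorem symmetrizerC_mul_cartanC (r : ℕ) (i j : Fin r) :
    symmetrizerC r i * cartanC r i j = symmetrizerC r j * cartanC r j i := by
  have hi := i.isLt
  have hj := j.isLt
  simp only [symmetrizerC, cartanC, Matrix.transpose_apply, CartanMatrix.C, Matrix.of_apply,
    Fin.ext_iff]
  split_ifs <;> omega

/-- The first fundamental weight. -/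
def omegaOne (r : ℕ) : Fin r → ℂ := fun i => if i.val = 0 then 1 else 0

/-- The tuple `(1, …, 1, 0, …, 0)` with `k` ones. -/
def tupleOne (r k : ℕ) : Fin r → ℕ := fun i => if i.val < k then 1 else 0

/-- The tuple `(1, …, 1, 2, …, 2, 1)` of length `r` that starts with `k` ones (`k + 2 ≤ r`). -/
def tupleTwo (r k : ℕ) : Fin r → ℕ := fun i =>
  if i.val < k then 1 else if i.val + 1 < r then 2 else 1

/-- The tuples `l` such that `λ + ω₁ - α(l)` is on the list of weights of the decomposition
`V_λ ⊗ V_{ω₁} = V_{λ+ω₁} ⊕ V_{λ+ω₁-α₁} ⊕ … ⊕ V_{λ+ω₁-2α₁-…-2α_{r-1}-α_r}`. -/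
def IsListed (r : ℕ) (l : Fin r → ℕ) : Prop :=
  (∃ k, k ≤ r ∧ l = tupleOne r k) ∨ (∃ k, k + 2 ≤ r ∧ l = tupleTwo r k)

/-- `V_{λ+ω₁-α(l)}` appears in the above decomposition, in which the summands whose highest weight
is not dominant are omitted. -/
def IsAdmissible {r : ℕ} (la : Fin r → ℂ) (l : Fin r → ℕ) : Prop :=
  IsListed r l ∧ IsDominantIntegral (la + omegaOne r - rootCombination (cartanC r) l)

end TypeC

/-! ### The explicit polynomials

In the formulas, indices of the coordinates of `λ` are one-based, and `m` stands for `2r - l`. -/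

section Explicit

/-- The coordinate `λ_i`, `1 ≤ i ≤ r`. -/
def coord {r : ℕ} (la : Fin r → ℂ) (i : ℕ) : ℂ :=
  if h : 1 ≤ i ∧ i ≤ r then la ⟨i - 1, by omega⟩ else 0

/-- `λ_a + … + λ_b`. -/
def partialSum {r : ℕ} (la : Fin r → ℂ) (a b : ℕ) : ℂ := ∑ i ∈ Finset.Icc a b, coord la i

/-- `c_j^{(l)}` for `l < r`. -/
def cSmall {r : ℕ} (la : Fin r → ℂ) (l j : ℕ) : ℂ :=
  ∏ i ∈ Finset.Icc 1 j,
    (partialSum la i l + l - i) / (partialSum la i l + l - i + 1)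

/-- `∏_{i=1}^{j} (λ_i+…+λ_{r-1}+2λ_r+r+1-i)/(λ_i+…+λ_{r-1}+2λ_r+r+2-i)`. -/
def prodMiddle {r : ℕ} (la : Fin r → ℂ) (j : ℕ) : ℂ :=
  ∏ i ∈ Finset.Icc 1 j,
    (partialSum la i (r - 1) + 2 * coord la r + r + 1 - i) /
      (partialSum la i (r - 1) + 2 * coord la r + r + 2 - i)

/-- `c_j^{(r)}`. -/
def cMiddle {r : ℕ} (la : Fin r → ℂ) (j : ℕ) : ℂ :=
  if j = r then coord la r / (coord la r + 1) * prodMiddle la (r - 1) else prodMiddle la j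

/-- `∏_{i=1}^{j} (λ_i+…+λ_{m-1}+2λ_m+…+2λ_r+l+1-i)/(λ_i+…+λ_{m-1}+2λ_m+…+2λ_r+l+2-i)`;
this is `c_j^{(l)}` for `l > r` and `1 ≤ j ≤ m - 1`. -/
def cLarge {r : ℕ} (la : Fin r → ℂ) (l j : ℕ) : ℂ :=
  ∏ i ∈ Finset.Icc 1 j,
    (partialSum la i (2 * r - l - 1) + 2 * partialSum la (2 * r - l) r + l + 1 - i) /
      (partialSum la i (2 * r - l - 1) + 2 * partialSum la (2 * r - l) r + l + 2 - i)

/-- `∏_{i=a}^{b} (λ_m+…+λ_i+2λ_{i+1}+…+2λ_r+l-i)/(λ_m+…+λ_i+2λ_{i+1}+…+2λ_r+l-i+1)`. -/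
def prodLarge {r : ℕ} (la : Fin r → ℂ) (l a b : ℕ) : ℂ :=
  ∏ i ∈ Finset.Icc a b,
    (partialSum la (2 * r - l) i + 2 * partialSum la (i + 1) r + l - i) /
      (partialSum la (2 * r - l) i + 2 * partialSum la (i + 1) r + l - i + 1)

/-- `c_r^{(l)}` for `l > r`. -/
def cLast {r : ℕ} (la : Fin r → ℂ) (l : ℕ) : ℂ :=
  cLarge la l (2 * r - l - 1) * prodLarge la l (2 * r - l) r

/-- The product `a_k^{(l)} b_k^{(l)}` for `l > r` and `m ≤ k ≤ r - 1`. -/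
def abProd {r : ℕ} (la : Fin r → ℂ) (l k : ℕ) : ℂ :=
  cLarge la l (2 * r - l - 1) ^ 2 * prodLarge la l (2 * r - l) (k - 1) *
    prodLarge la l (2 * r - l) r *
    ∏ i ∈ Finset.Icc 1 (r + 1 - k),
      (partialSum la (2 * r - l) (r + 1 - i) + l + 1 - i - r) /
        (partialSum la (2 * r - l) (r + 1 - i) + l + 2 - i - r)

/-- The sum `a_k^{(l)} + b_k^{(l)}` for `l > r` and `m ≤ k ≤ r - 1`. -/
def abSum {r : ℕ} (la : Fin r → ℂ) (l k : ℕ) : ℂ :=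
  cLarge la l (2 * r - l - 1) * prodLarge la l (2 * r - l) (k - 1) *
    ((2 * partialSum la (2 * r - l) r + 2 * l - 2 * r) /
        (2 * partialSum la (2 * r - l) r + 2 * l + 1 - 2 * r) +
      (2 * partialSum la (2 * r - l) r + 2 * l + 2 - 2 * r) /
        (2 * partialSum la (2 * r - l) r + 2 * l + 1 - 2 * r) *
      prodLarge la l k r *
      ∏ i ∈ Finset.Icc k r,
        (partialSum la (2 * r - l) i + l + i - 2 * r) /
          (partialSum la (2 * r - l) i + l + i + 1 - 2 * r))

/-- The polynomial `y_j^{(l)}`, `1 ≤ j ≤ r`, `0 ≤ l ≤ 2r - 1`. The quadratic polynomial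
`(x - a)(x - b)` is written as `x² - (a + b) x + ab`. -/
def explicitPoly {r : ℕ} (la : Fin r → ℂ) (l j : ℕ) : ℂ[X] :=
  if l < r then
    if j ≤ l then Polynomial.X - Polynomial.C (cSmall la l j) else 1
  else if l = r then Polynomial.X - Polynomial.C (cMiddle la j)
  else if j = r then Polynomial.X - Polynomial.C (cLast la l)
  else if j < 2 * r - l then Polynomial.X - Polynomial.C (cLarge la l j)
  else Polynomial.X ^ 2 - Polynomial.C (abSum la l j) * Polynomial.X +
    Polynomial.C (abProd la l j)

end Explicit

end

end Gaudin

namespace Gaudin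

open Polynomial

/-! Put y_0 = x - 1 and y_{r+1} = 1. After division by the symmetrizer, the Bethe equation of colour
k says that at every root of y_k one has y_k''/y_k' = λ_k/x + y_{k-1}'/y_{k-1} + m_k
y_{k+1}'/y_{k+1}, where m_{r-1} = 2 and m_k = 1 otherwise (`isBetheSolution_iff`). All y_k have
degree at most 2, and the tuples satisfying this are found shape by shape.

Colours with one root s_k are solved downwards. If colour k+1 contributes E to the equation of
colour k and E s_k = S is a natural number, then s_k = T/(T+1) s_{k-1} with T = λ_k + S, and colour
k contributes to colour k-1 a term whose product with s_{k-1} is T + 1 (`chain_step`). Only the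
starting value of S depends on the shape.

For l = (1, …, 1, 2, …, 2, 1) with n leading ones, replacing y_r by its square turns the double link
into a simple one, so colours n+1, …, r all carry monic quadratics. Colour n+1 is reflected: there
is a linear x - c such that the Wronskian of y_{n+1} and x^{μ+1}(x - c) equals μ x^μ (x - c_n)
y_{n+2}, where μ = λ_{n+1} and c_n = s_n. At the roots of y_{n+2} this rewrites y_{n+1}'/y_{n+1} as
(μ+1)/x + 1/(x - c), so colour n+2 satisfies an equation of the same kind with weight μ + 1 +
λ_{n+2}, and the reflection can be repeated (`PairEquations.exists_isReflection`). The equation of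
colour r then relates its root to c_{r-1}. Going back down, the number c_k
y_{k+1}'(c_k)/y_{k+1}(c_k) = 2N + 2 does not depend on k, where N is the last weight, and this
determines all c_k and all coefficients (`PairEquations.isExplicitPair`). It also provides the
starting value of S for the linear colours.

Conversely the reflection identities, with strict inequalities between real ratios that exclude
double roots, show that the explicit tuple is a solution (`IsExplicitPair.pairEquations`). The only
obstruction is the vanishing of one coordinate of λ, and this is exactly failure of dominance of λ +
ω_1 - α(l). -/

/-- The multiplicity of the logarithmic derivative of `y_{n+1}` in the equation for `y_n`. -/
noncomputable def nextMult (r n : ℕ) : ℂ := if n + 1 = r then 2 else 1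

/-! ### Rows of the Cartan matrix of type C -/

theorem coord_succ {r : ℕ} (f : Fin r → ℂ) (i : Fin r) : coord f (i.val + 1) = f i := by
  have := i.isLt
  simp [coord]

theorem coord_zero {r : ℕ} (f : Fin r → ℂ) : coord f 0 = 0 := by simp [coord]

theorem coord_of_lt {r n : ℕ} (f : Fin r → ℂ) (h : r < n) : coord f n = 0 := by
  have : ¬ n ≤ r := by omega
  simp [coord, this]

theorem sum_ite_val_eq {r : ℕ} (f : Fin r → ℂ) (n : ℕ) :
    ∑ j : Fin r, (if j.val + 1 = n then f j else 0) = coord f n := by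
  unfold coord
  split_ifs with h
  · rw [Finset.sum_eq_single ⟨n - 1, by omega⟩]
    · simp; omega
    · intro b _ hb
      rw [if_neg]
      rintro rfl
      exact hb (by simp)
    · simp
  · refine Finset.sum_eq_zero fun j _ => if_neg ?_
    have := j.isLt
    omega

theorem sum_cartanC_mul {r : ℕ} (f : Fin r → ℂ) (i : Fin r) :
    ∑ j, (cartanC r i j : ℂ) * f j =
      2 * coord f (i.val + 1) - coord f i.val - nextMult r (i.val + 1) * coord f (i.val + 2) := by
  have hi := i.isLt
  rw [← sum_ite_val_eq, ← sum_ite_val_eq, ← sum_ite_val_eq, Finset.mul_sum, Finset.mul_sum,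
    ← Finset.sum_sub_distrib, ← Finset.sum_sub_distrib]
  refine Finset.sum_congr rfl fun j _ => ?_
  have hj := j.isLt
  simp only [cartanC, Matrix.transpose_apply, CartanMatrix.C, Matrix.of_apply, Fin.ext_iff,
    nextMult]
  split_ifs <;> first | omega | simp

theorem symmetrizerC_ne_zero (r : ℕ) (i : Fin r) : (symmetrizerC r i : ℂ) ≠ 0 := by
  unfold symmetrizerC
  split_ifs <;> simp

theorem rootPairing_ne_zero_iff {r : ℕ} (i j : Fin r) :
    rootPairing (cartanC r) (symmetrizerC r) i j ≠ 0 ↔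
      i = j ∨ j.val + 1 = i.val ∨ i.val + 1 = j.val := by
  have hs := symmetrizerC_ne_zero r i
  simp only [rootPairing, Int.cast_mul, ne_eq, mul_eq_zero, hs, false_or]
  simp only [cartanC, Matrix.transpose_apply, CartanMatrix.C, Matrix.of_apply, Fin.ext_iff]
  split_ifs <;> simp <;> omega

/-! ### Bethe equations as conditions on polynomials -/

/-- The polynomials representing `t`, numbered from `1` to `r` and completed by `y_0 = x - 1` and
`y_n = 1` for `n > r`. -/
noncomputable def extendedTuple {r : ℕ} {l : Fin r → ℕ} (t : Var l → ℂ) (n : ℕ) : ℂ[X] :=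
  if h : 1 ≤ n ∧ n ≤ r then representingTuple t ⟨n - 1, by omega⟩ else if n = 0 then X - C 1 else 1

theorem extendedTuple_succ {r : ℕ} {l : Fin r → ℕ} (t : Var l → ℂ) (i : Fin r) :
    extendedTuple t (i.val + 1) = representingTuple t i := by
  have := i.isLt
  simp [extendedTuple]

theorem extendedTuple_zero {r : ℕ} {l : Fin r → ℕ} (t : Var l → ℂ) :
    extendedTuple t 0 = X - C 1 := by
  simp [extendedTuple]

theorem extendedTuple_of_lt {r n : ℕ} {l : Fin r → ℕ} (t : Var l → ℂ) (h : r < n) :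
    extendedTuple t n = 1 := by
  have h1 : ¬ n ≤ r := by omega
  have h2 : n ≠ 0 := by omega
  simp [extendedTuple, h1, h2]

/-- The Bethe ansatz equation at a root `x` of `y`, in terms of the polynomials `a`, `y`, `b` of
three consecutive colors. -/
structure IsCriticalAt (lam k : ℂ) (a y b : ℂ[X]) (x : ℂ) : Prop where
  ne_zero : lam ≠ 0 → x ≠ 0
  prev : a.eval x ≠ 0
  next : b.eval x ≠ 0
  simple : y.derivative.eval x ≠ 0
  eqn : y.derivative.derivative.eval x / y.derivative.eval x =
    lam / x + a.derivative.eval x / a.eval x + k * (b.derivative.eval x / b.eval x)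

theorem eval_prod_X_sub_C {ι : Type*} (s : Finset ι) (f : ι → ℂ) (x : ℂ) :
    (∏ j ∈ s, (X - C (f j))).eval x = ∏ j ∈ s, (x - f j) := by
  simp [eval_prod]

theorem logDeriv_prod_X_sub_C {ι : Type*} (s : Finset ι) (f : ι → ℂ) (x : ℂ)
    (h : ∀ j ∈ s, x ≠ f j) :
    (∏ j ∈ s, (X - C (f j))).derivative.eval x / (∏ j ∈ s, (X - C (f j))).eval x =
      ∑ j ∈ s, 1 / (x - f j) := by
  classical
  induction s using Finset.induction_on with
  | empty => simp
  | insert a s ha ih =>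
    have h1 : x - f a ≠ 0 := sub_ne_zero.2 (h a (Finset.mem_insert_self a s))
    have h2 : (∏ j ∈ s, (X - C (f j))).eval x ≠ 0 := by
      rw [eval_prod_X_sub_C]
      exact Finset.prod_ne_zero_iff.2 fun j hj =>
        sub_ne_zero.2 (h j (Finset.mem_insert_of_mem hj))
    rw [Finset.sum_insert ha, ← ih fun j hj => h j (Finset.mem_insert_of_mem hj),
      Finset.prod_insert ha]
    simp only [derivative_mul, derivative_sub, derivative_X, derivative_C, eval_add, eval_mul,
      eval_sub, eval_X, eval_C, sub_zero, one_mul]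
    field_simp

theorem representingTuple_eq_mul {r : ℕ} {l : Fin r → ℕ} (t : Var l → ℂ) (i : Fin r)
    (j : Fin (l i)) : representingTuple t i =
      (X - C (t ⟨i, j⟩)) * ∏ j' ∈ Finset.univ.erase j, (X - C (t ⟨i, j'⟩)) :=
  (Finset.mul_prod_erase _ _ (Finset.mem_univ j)).symm

theorem eval_representingTuple_ne_zero_iff {r : ℕ} {l : Fin r → ℕ} (t : Var l → ℂ) (i : Fin r)
    (x : ℂ) : (representingTuple t i).eval x ≠ 0 ↔ ∀ j, x ≠ t ⟨i, j⟩ := by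
  rw [representingTuple, eval_prod_X_sub_C, Finset.prod_ne_zero_iff]
  simp [sub_ne_zero]

theorem eval_representingTuple_eq_zero_iff {r : ℕ} {l : Fin r → ℕ} (t : Var l → ℂ) (i : Fin r)
    (x : ℂ) : (representingTuple t i).eval x = 0 ↔ ∃ j, x = t ⟨i, j⟩ := by
  rw [← not_iff_not]
  simpa using eval_representingTuple_ne_zero_iff t i x

theorem eval_derivative_representingTuple {r : ℕ} {l : Fin r → ℕ} (t : Var l → ℂ) (i : Fin r)
    (j : Fin (l i)) : (representingTuple t i).derivative.eval (t ⟨i, j⟩) =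
      (∏ j' ∈ Finset.univ.erase j, (X - C (t ⟨i, j'⟩))).eval (t ⟨i, j⟩) := by
  rw [representingTuple_eq_mul t i j]
  simp [derivative_mul]

theorem eval_derivative_representingTuple_ne_zero_iff {r : ℕ} {l : Fin r → ℕ} (t : Var l → ℂ)
    (i : Fin r) (j : Fin (l i)) : (representingTuple t i).derivative.eval (t ⟨i, j⟩) ≠ 0 ↔
      ∀ j', j' ≠ j → t ⟨i, j⟩ ≠ t ⟨i, j'⟩ := by
  rw [eval_derivative_representingTuple, eval_prod_X_sub_C, Finset.prod_ne_zero_iff]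
  simp [sub_ne_zero]

/-- Writing y = (x - t) u, one has y'(t) = u(t) and y''(t) = 2 u'(t), so the quotient is twice the
logarithmic derivative of u. -/
theorem second_derivative_representingTuple {r : ℕ} {l : Fin r → ℕ} (t : Var l → ℂ) (i : Fin r)
    (j : Fin (l i)) (h : ∀ j', j' ≠ j → t ⟨i, j⟩ ≠ t ⟨i, j'⟩) :
    (representingTuple t i).derivative.derivative.eval (t ⟨i, j⟩) /
      (representingTuple t i).derivative.eval (t ⟨i, j⟩) =
      2 * ∑ j', 1 / (t ⟨i, j⟩ - t ⟨i, j'⟩) := by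
  -- The summand `j' = j` is `1 / 0 = 0`, so it may be split off.
  rw [eval_derivative_representingTuple, ← Finset.add_sum_erase _ _ (Finset.mem_univ j), sub_self,
    div_zero, zero_add, ← logDeriv_prod_X_sub_C (Finset.univ.erase j) (fun j' => t ⟨i, j'⟩)
      (t ⟨i, j⟩) fun j' hj' => h j' (Finset.ne_of_mem_erase hj')]
  rw [representingTuple_eq_mul t i j]
  simp only [derivative_mul, derivative_sub, derivative_X, derivative_C, derivative_add,
    eval_add, eval_mul, eval_sub, eval_X, eval_C, sub_zero, one_mul,
    sub_self, zero_mul]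
  ring

theorem logDeriv_extendedTuple {r : ℕ} {l : Fin r → ℕ} (t : Var l → ℂ) (n : ℕ) (hn : 1 ≤ n)
    (x : ℂ) (h : (extendedTuple t n).eval x ≠ 0) :
    (extendedTuple t n).derivative.eval x / (extendedTuple t n).eval x =
      coord (fun i => ∑ j, 1 / (x - t ⟨i, j⟩)) n := by
  by_cases hr : n ≤ r
  · obtain ⟨n, rfl⟩ : ∃ i, n = i + 1 := ⟨n - 1, by omega⟩
    have h1 := coord_succ (fun i => ∑ j, 1 / (x - t ⟨i, j⟩)) ⟨n, hr⟩
    have h2 := extendedTuple_succ t ⟨n, hr⟩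
    simp only at h1 h2
    rw [h2] at h ⊢
    rw [h1]
    exact logDeriv_prod_X_sub_C _ _ _ fun j _ =>
      (eval_representingTuple_ne_zero_iff t _ x).1 h j
  · rw [extendedTuple_of_lt t (by omega), coord_of_lt _ (by omega)]
    simp

theorem sum_rootPairing_div {r : ℕ} {l : Fin r → ℕ} (t : Var l → ℂ) (p : Var l) :
    ∑ q ∈ Finset.univ.erase p,
        rootPairing (cartanC r) (symmetrizerC r) p.1 q.1 / (t p - t q) =
      symmetrizerC r p.1 * ∑ i, (cartanC r p.1 i : ℂ) * ∑ j, 1 / (t p - t ⟨i, j⟩) := by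
  -- Since division by zero gives zero, the excluded diagonal term can be restored and the sum
  -- becomes a sum over colours.
  have h : rootPairing (cartanC r) (symmetrizerC r) p.1 p.1 / (t p - t p) = 0 := by simp
  rw [← zero_add (∑ q ∈ Finset.univ.erase p, _), ← h,
    Finset.add_sum_erase _ (fun q => rootPairing (cartanC r) (symmetrizerC r) p.1 q.1 /
      (t p - t q)) (Finset.mem_univ p), Fintype.sum_sigma, Finset.mul_sum]
  refine Finset.sum_congr rfl fun i _ => ?_
  rw [Finset.mul_sum, Finset.mul_sum]
  refine Finset.sum_congr rfl fun j _ => ?_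
  simp only [rootPairing, Int.cast_mul]
  ring

theorem isBetheSolution_iff {r : ℕ} (la : Fin r → ℂ) {l : Fin r → ℕ}
    (t : Var l → ℂ) :
    IsBetheSolution (cartanC r) (symmetrizerC r) ![la, omegaOne r] ![0, 1] l t ↔
      ∀ n, 1 ≤ n → n ≤ r → ∀ x, (extendedTuple t n).eval x = 0 →
        IsCriticalAt (coord la n) (nextMult r n) (extendedTuple t (n - 1)) (extendedTuple t n)
          (extendedTuple t (n + 1)) x := by
  have key : IsBetheSolution (cartanC r) (symmetrizerC r) ![la, omegaOne r] ![0, 1] l t ↔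
      ∀ (i : Fin r) (j : Fin (l i)), IsCriticalAt (la i) (nextMult r (i.val + 1))
        (extendedTuple t i.val) (representingTuple t i) (extendedTuple t (i.val + 2))
        (t ⟨i, j⟩) := by
    have hprev : ∀ (i : Fin r) (x : ℂ), (extendedTuple t i.val).eval x ≠ 0 ↔
        ((i.val = 0 → x ≠ 1) ∧ ∀ i' : Fin r, i'.val + 1 = i.val → ∀ j, x ≠ t ⟨i', j⟩) := by
      intro i x
      have hi := i.isLt
      by_cases h0 : i.val = 0
      · rw [h0, extendedTuple_zero]
        simp [sub_ne_zero]
      · obtain ⟨i', hi'⟩ : ∃ i' : Fin r, i'.val + 1 = i.val :=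
          ⟨⟨i.val - 1, by omega⟩, by simp; omega⟩
        rw [← hi', extendedTuple_succ, eval_representingTuple_ne_zero_iff]
        refine ⟨fun h => ⟨fun h' => absurd h' (by omega), fun i'' h'' => ?_⟩,
          fun h => h.2 i' rfl⟩
        obtain rfl : i'' = i' := Fin.ext (by omega)
        exact h
    have hnext : ∀ (i : Fin r) (x : ℂ), (extendedTuple t (i.val + 2)).eval x ≠ 0 ↔
        ∀ i' : Fin r, i.val + 1 = i'.val → ∀ j, x ≠ t ⟨i', j⟩ := by
      intro i x
      by_cases h0 : i.val + 1 < r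
      · have := extendedTuple_succ t ⟨i.val + 1, h0⟩
        simp only at this
        rw [this, eval_representingTuple_ne_zero_iff]
        refine ⟨fun h i'' h'' => ?_, fun h => h ⟨i.val + 1, h0⟩ rfl⟩
        obtain rfl : i'' = ⟨i.val + 1, h0⟩ := Fin.ext h''.symm
        exact h
      · rw [extendedTuple_of_lt t (by omega)]
        simp only [eval_one, ne_eq, one_ne_zero, not_false_eq_true, true_iff]
        intro i' h'
        have := i'.isLt
        omega
    have heqn : ∀ (i : Fin r) (j : Fin (l i)), (extendedTuple t i.val).eval (t ⟨i, j⟩) ≠ 0 →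
        (extendedTuple t (i.val + 2)).eval (t ⟨i, j⟩) ≠ 0 →
        (∀ j', j' ≠ j → t ⟨i, j⟩ ≠ t ⟨i, j'⟩) →
        ((-(∑ s, weightPairing (symmetrizerC r) i (![la, omegaOne r] s) /
            (t ⟨i, j⟩ - ![0, 1] s)) + ∑ q ∈ Finset.univ.erase (⟨i, j⟩ : Var l),
          rootPairing (cartanC r) (symmetrizerC r) i q.1 / (t ⟨i, j⟩ - t q) = 0) ↔
        (representingTuple t i).derivative.derivative.eval (t ⟨i, j⟩) /
            (representingTuple t i).derivative.eval (t ⟨i, j⟩) = la i / t ⟨i, j⟩ +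
          (extendedTuple t i.val).derivative.eval (t ⟨i, j⟩) /
            (extendedTuple t i.val).eval (t ⟨i, j⟩) +
          nextMult r (i.val + 1) * ((extendedTuple t (i.val + 2)).derivative.eval (t ⟨i, j⟩) /
            (extendedTuple t (i.val + 2)).eval (t ⟨i, j⟩))) := by
      intro i j h1 h2 h3
      have hs := symmetrizerC_ne_zero r i
      have hsum := sum_rootPairing_div t ⟨i, j⟩
      simp only at hsum
      rw [hsum, second_derivative_representingTuple t i j h3,
        logDeriv_extendedTuple t _ (by omega) _ h2, sum_cartanC_mul, coord_succ]
      set H : Fin r → ℂ := fun i' => ∑ j', 1 / (t ⟨i, j⟩ - t ⟨i', j'⟩) with hH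
      have hL : (extendedTuple t i.val).derivative.eval (t ⟨i, j⟩) /
          (extendedTuple t i.val).eval (t ⟨i, j⟩) =
          omegaOne r i / (t ⟨i, j⟩ - 1) + coord H i.val := by
        by_cases h0 : i.val = 0
        · rw [h0, extendedTuple_zero, coord_zero]
          simp [omegaOne, h0]
        · rw [logDeriv_extendedTuple t _ (by omega) _ h1]
          simp [omegaOne, h0, hH]
      rw [hL]
      simp only [Fin.sum_univ_two, Matrix.cons_val_zero, Matrix.cons_val_one, weightPairing,
        sub_zero]
      constructor
      · intro h
        refine sub_eq_zero.1 (mul_left_cancel₀ hs ?_)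
        rw [mul_zero, ← h]
        ring
      · intro h
        have h' := sub_eq_zero.2 h
        rw [← mul_zero (symmetrizerC r i : ℂ), ← h']
        ring
    have hom : ∀ i : Fin r, omegaOne r i ≠ 0 ↔ i.val = 0 := by
      intro i
      simp [omegaOne]
    constructor
    · rintro ⟨ha, hb, hc⟩ i j
      have hp : (extendedTuple t i.val).eval (t ⟨i, j⟩) ≠ 0 := by
        refine (hprev i _).2 ⟨fun h0 => ?_, fun i' hi' j' => ?_⟩
        · refine ha ⟨i, j⟩ 1 ?_
          exact mul_ne_zero (symmetrizerC_ne_zero r i) ((hom i).2 h0)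
        · refine hb ⟨i, j⟩ ⟨i', j'⟩ (fun h => ?_)
            ((rootPairing_ne_zero_iff _ _).2 (Or.inr (Or.inl hi')))
          have := congrArg (fun p : Var l => p.1.val) h
          simp only at this
          omega
      have hn : (extendedTuple t (i.val + 2)).eval (t ⟨i, j⟩) ≠ 0 := by
        refine (hnext i _).2 fun i' hi' j' => ?_
        refine hb ⟨i, j⟩ ⟨i', j'⟩ (fun h => ?_)
          ((rootPairing_ne_zero_iff _ _).2 (Or.inr (Or.inr hi')))
        have := congrArg (fun p : Var l => p.1.val) h
        simp only at this
        omega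
      have hd : ∀ j', j' ≠ j → t ⟨i, j⟩ ≠ t ⟨i, j'⟩ := by
        intro j' hj'
        refine hb ⟨i, j⟩ ⟨i, j'⟩ (fun h => hj' ?_)
          ((rootPairing_ne_zero_iff _ _).2 (Or.inl rfl))
        simpa using h.symm
      refine ⟨fun h0 => ?_, hp, hn, (eval_derivative_representingTuple_ne_zero_iff t i j).2 hd,
        (heqn i j hp hn hd).1 (hc ⟨i, j⟩)⟩
      exact ha ⟨i, j⟩ 0 (mul_ne_zero (symmetrizerC_ne_zero r i) h0)
    · intro h
      refine ⟨?_, ?_, ?_⟩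
      · rintro ⟨i, j⟩ s hs
        have hs' : (![la, omegaOne r] s) i ≠ 0 := fun h0 => hs (by simp [weightPairing, h0])
        fin_cases s
        · exact (h i j).ne_zero hs'
        · exact ((hprev i _).1 (h i j).prev).1 ((hom i).1 hs')
      · rintro ⟨i, j⟩ ⟨i', j'⟩ hne hrp
        rcases (rootPairing_ne_zero_iff _ _).1 hrp with h0 | h0 | h0
        · obtain rfl : i = i' := h0
          refine (eval_derivative_representingTuple_ne_zero_iff t i j).1 (h i j).simple j' ?_
          rintro rfl
          exact hne rfl
        · exact ((hprev i _).1 (h i j).prev).2 i' h0 j'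
        · exact (hnext i _).1 (h i j).next i' h0 j'
      · rintro ⟨i, j⟩
        exact (heqn i j (h i j).prev (h i j).next
          ((eval_derivative_representingTuple_ne_zero_iff t i j).1 (h i j).simple)).2 (h i j).eqn
  rw [key]
  constructor
  · intro h n hn hnr x hx
    obtain ⟨n, rfl⟩ : ∃ i, n = i + 1 := ⟨n - 1, by omega⟩
    have h2 := extendedTuple_succ t ⟨n, hnr⟩
    have h3 := coord_succ la ⟨n, hnr⟩
    simp only at h2 h3
    rw [h2] at hx ⊢
    rw [h3]
    obtain ⟨j, rfl⟩ := (eval_representingTuple_eq_zero_iff t _ x).1 hx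
    exact h ⟨n, hnr⟩ j
  · intro h i j
    have := h (i.val + 1) (by omega) i.isLt (t ⟨i, j⟩)
    rw [extendedTuple_succ, coord_succ] at this
    exact this ((eval_representingTuple_eq_zero_iff t _ _).2 ⟨j, rfl⟩)

/-! ### Passing between solutions and polynomials -/

/-- Solutions represented by the same polynomials differ by a permutation of the variables. -/
theorem sameOrbit_of_representingTuple_eq {r : ℕ} {l : Fin r → ℕ} {t t' : Var l → ℂ}
    (hinj : ∀ i j j', t' ⟨i, j⟩ = t' ⟨i, j'⟩ → j = j')
    (h : ∀ i, representingTuple t i = representingTuple t' i) : SameOrbit t t' := by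
  have h1 : ∀ i (j : Fin (l i)), ∃ j', t' ⟨i, j⟩ = t ⟨i, j'⟩ := by
    intro i j
    rw [← eval_representingTuple_eq_zero_iff t i, h, eval_representingTuple_eq_zero_iff]
    exact ⟨j, rfl⟩
  choose σ hσ using h1
  have h2 : ∀ i, Function.Bijective (σ i) := by
    intro i
    refine Finite.injective_iff_bijective.1 fun j j' hj => hinj i j j' ?_
    rw [hσ, hσ, hj]
  exact ⟨Equiv.sigmaCongrRight fun i => Equiv.ofBijective (σ i) (h2 i), fun p => rfl,
    fun p => hσ p.1 p.2⟩

theorem exists_prod_X_sub_C {y : ℂ[X]} (hy : y.Monic) {n : ℕ} (hn : y.natDegree = n) :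
    ∃ f : Fin n → ℂ, ∏ j, (X - C (f j)) = y := by
  subst hn
  induction h : y.natDegree generalizing y with
  | zero => exact ⟨fun _ => 0, by simp [hy.natDegree_eq_zero.1 h]⟩
  | succ n ih =>
    have hd : y.degree ≠ 0 := by
      rw [degree_eq_natDegree hy.ne_zero, h]
      norm_cast
    obtain ⟨a, ha⟩ := IsAlgClosed.exists_root y hd
    obtain ⟨g, rfl⟩ := dvd_iff_isRoot.2 ha
    have hg : g.Monic := (monic_X_sub_C a).of_mul_monic_left hy
    have hgn : g.natDegree = n := by
      have := (monic_X_sub_C a).natDegree_mul hg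
      rw [h, natDegree_X_sub_C] at this
      omega
    obtain ⟨f, hf⟩ := ih hg hgn
    exact ⟨Fin.cons a f, by simp [Fin.prod_univ_succ, hf]⟩

theorem exists_representingTuple {r : ℕ} {l : Fin r → ℕ} (y : Fin r → ℂ[X])
    (hy : ∀ i, (y i).Monic) (hn : ∀ i, (y i).natDegree = l i) :
    ∃ t : Var l → ℂ, ∀ i, representingTuple t i = y i := by
  choose f hf using fun i => exists_prod_X_sub_C (hy i) (hn i)
  exact ⟨fun p => f p.1 p.2, hf⟩

/-! ### The reflection identity -/

/-- A cubic polynomial with two double roots vanishes. -/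
theorem cubic_eq_zero_of_double_roots {w₃ w₂ w₁ w₀ a b : ℂ} (hab : a ≠ b)
    (h1 : w₃ * a ^ 3 + w₂ * a ^ 2 + w₁ * a + w₀ = 0)
    (h2 : w₃ * b ^ 3 + w₂ * b ^ 2 + w₁ * b + w₀ = 0)
    (h3 : 3 * w₃ * a ^ 2 + 2 * w₂ * a + w₁ = 0) (h4 : 3 * w₃ * b ^ 2 + 2 * w₂ * b + w₁ = 0) :
    w₃ = 0 ∧ w₂ = 0 ∧ w₁ = 0 ∧ w₀ = 0 := by
  have hd : a - b ≠ 0 := sub_ne_zero.2 hab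
  have e3 : w₃ = 0 := by
    have : (a - b) ^ 3 * w₃ = 0 := by
      linear_combination (a - b) * (h3 + h4) - 2 * (h1 - h2)
    exact (mul_eq_zero.1 this).resolve_left (pow_ne_zero 3 hd)
  subst e3
  have e2 : w₂ = 0 := by
    have : (a - b) * w₂ = 0 := by linear_combination (h3 - h4) / 2
    exact (mul_eq_zero.1 this).resolve_left hd
  subst e2
  have e1 : w₁ = 0 := by linear_combination h3
  subst e1
  exact ⟨rfl, rfl, rfl, by linear_combination h1⟩

theorem exists_roots_of_simple {p q : ℂ} (h : ∀ x, x ^ 2 - p * x + q = 0 → 2 * x - p ≠ 0) :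
    ∃ a b, a ≠ b ∧ p = a + b ∧ q = a * b := by
  obtain ⟨d, hd⟩ := IsAlgClosed.exists_pow_nat_eq (p ^ 2 - 4 * q) (n := 2) (by norm_num)
  refine ⟨(p + d) / 2, (p - d) / 2, fun hab => ?_, by ring, by linear_combination hd / 4⟩
  refine h ((p + d) / 2) (by linear_combination hd / 4) ?_
  linear_combination hab

theorem exists_linear_interpolation {a b : ℂ} (hab : a ≠ b) (u v : ℂ) :
    ∃ α β, α * a + β = u ∧ α * b + β = v := by
  have hd : a - b ≠ 0 := sub_ne_zero.2 hab
  refine ⟨(u - v) / (a - b), u - (u - v) / (a - b) * a, by ring, ?_⟩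
  field_simp
  ring

/-- The identity `(μ + 1) y ỹ + x (y ỹ' - y' ỹ) = μ (x - c₀) y₊` between the polynomials
`y = x² - p x + q`, `y₊ = x² - p₊ x + q₊` and `ỹ = x - c`, in terms of coefficients. -/
structure IsReflection (μ c₀ c p q p' q' : ℂ) : Prop where
  quad : (μ + 1) * p + (μ - 1) * c = μ * (c₀ + p')
  lin : (μ + 2) * q + μ * p * c = μ * (q' + p' * c₀)
  const : (μ + 1) * q * c = μ * q' * c₀

theorem IsReflection.eval {μ c₀ c p q p' q' : ℂ} (h : IsReflection μ c₀ c p q p' q') (x : ℂ) :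
    (μ + 1) * (x ^ 2 - p * x + q) * (x - c) +
      x * ((x ^ 2 - p * x + q) - (2 * x - p) * (x - c)) =
      μ * (x - c₀) * (x ^ 2 - p' * x + q') := by
  linear_combination -x ^ 2 * h.quad + x * h.lin - h.const

theorem IsReflection.eval_derivative {μ c₀ c p q p' q' : ℂ}
    (h : IsReflection μ c₀ c p q p' q') (x : ℂ) :
    (μ + 2) * (x ^ 2 - p * x + q) + μ * (2 * x - p) * (x - c) - 2 * x * (x - c) =
      μ * ((x ^ 2 - p' * x + q') + (x - c₀) * (2 * x - p')) := by
  linear_combination -2 * x * h.quad + h.lin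

/-- At a root of y the value of the left side of the identity, and of its derivative, involve ỹ but
not ỹ'. Hence `e` is the prescribed value of ỹ there: interpolating the two values makes the
difference of the two sides a cubic with two double roots. -/
theorem exists_isReflection {μ c₀ p q p' q' : ℂ} (hμ : μ ≠ 0)
    (hs : ∀ x, x ^ 2 - p * x + q = 0 → 2 * x - p ≠ 0)
    (h : ∀ x, x ^ 2 - p * x + q = 0 → ∃ e,
      -x * (2 * x - p) * e = μ * ((x - c₀) * (x ^ 2 - p' * x + q')) ∧
      μ * (2 * x - p) * e - 2 * x * e =
        μ * ((x ^ 2 - p' * x + q') + (x - c₀) * (2 * x - p'))) :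
    ∃ c, IsReflection μ c₀ c p q p' q' := by
  obtain ⟨a, b, hab, rfl, rfl⟩ := exists_roots_of_simple hs
  obtain ⟨u, hu1, hu2⟩ := h a (by ring)
  obtain ⟨v, hv1, hv2⟩ := h b (by ring)
  obtain ⟨α, β, rfl, rfl⟩ := exists_linear_interpolation hab u v
  -- The cubic is left side minus right side for ỹ = αx + β; its leading coefficient forces α = 1.
  obtain ⟨e3, e2, e1, e0⟩ := cubic_eq_zero_of_double_roots (w₃ := μ * α - μ)
    (w₂ := (μ + 1) * (β - (a + b) * α) - 2 * β + μ * (c₀ + p'))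
    (w₁ := (μ + 1) * (a * b * α - (a + b) * β) + a * b * α + (a + b) * β - μ * (q' + p' * c₀))
    (w₀ := (μ + 1) * (a * b) * β + μ * c₀ * q') hab
    (by linear_combination hu1) (by linear_combination hv1)
    (by linear_combination hu2) (by linear_combination hv2)
  have hα : α = 1 := mul_left_cancel₀ hμ (by linear_combination e3)
  subst hα
  exact ⟨-β, by linear_combination -e2, by linear_combination e1, by linear_combination -e0⟩

/-- Away from 0 the first condition determines `e`, and the second is then the Bethe equation. At x
= 0 = c₀ the first condition is empty and the second determines `e`. -/
theorem exists_interpolation_value {μ x c₀ d Q Q' : ℂ} (hd : d ≠ 0)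
    (h : x = 0 ∧ x = c₀ ∨
      x ≠ 0 ∧ x ≠ c₀ ∧ Q ≠ 0 ∧ 2 / d = μ / x + 1 / (x - c₀) + Q' / Q) :
    ∃ e, -x * d * e = μ * ((x - c₀) * Q) ∧
      μ * d * e - 2 * x * e = μ * (Q + (x - c₀) * Q') := by
  rcases h with ⟨rfl, rfl⟩ | ⟨hx, hc, hQ, h⟩
  · refine ⟨Q / d, by ring, ?_⟩
    field_simp
    ring
  · have hc' : x - c₀ ≠ 0 := sub_ne_zero.2 hc
    refine ⟨-μ * ((x - c₀) * Q) / (x * d), by field_simp, ?_⟩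
    field_simp at h ⊢
    linear_combination μ * h

/-- There is no quadratic polynomial `y` satisfying the Bethe ansatz equation of weight `0` with
neighbours of total degree three. -/
theorem not_critical_of_weight_zero {s p q p' q' : ℂ}
    (h : ∀ x, x ^ 2 - p * x + q = 0 → 2 * x - p ≠ 0 ∧ x ≠ s ∧ x ^ 2 - p' * x + q' ≠ 0 ∧
      2 / (2 * x - p) = 1 / (x - s) + (2 * x - p') / (x ^ 2 - p' * x + q')) : False := by
  obtain ⟨a, b, hab, rfl, rfl⟩ := exists_roots_of_simple fun x hx => (h x hx).1
  have key : ∀ x, x ^ 2 - (a + b) * x + a * b = 0 → ∃ e,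
      -(2 * x - (a + b)) * e = (x - s) * (x ^ 2 - p' * x + q') ∧
      -2 * e = (x ^ 2 - p' * x + q') + (x - s) * (2 * x - p') := by
    intro x hx
    obtain ⟨h1, h2, h3, h4⟩ := h x hx
    have h2' : x - s ≠ 0 := sub_ne_zero.2 h2
    refine ⟨-((x - s) * (x ^ 2 - p' * x + q')) / (2 * x - (a + b)), by field_simp, ?_⟩
    generalize x ^ 2 - p' * x + q' = Q at *
    generalize 2 * x - (a + b) = d at *
    field_simp at h4 ⊢
    linear_combination h4
  obtain ⟨u, hu1, hu2⟩ := key a (by ring)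
  obtain ⟨v, hv1, hv2⟩ := key b (by ring)
  obtain ⟨α, β, rfl, rfl⟩ := exists_linear_interpolation hab u v
  -- For weight 0 the Wronskian of y with a linear ỹ has degree at most 2, so it cannot equal the
  -- monic cubic (x - s) y₊; the difference has leading coefficient -1.
  obtain ⟨e3, -⟩ := cubic_eq_zero_of_double_roots (w₃ := -1)
    (w₂ := -α + s + p') (w₁ := -2 * β - q' - p' * s) (w₀ := a * b * α + (a + b) * β + s * q')
    hab (by linear_combination hu1) (by linear_combination hv1)
    (by linear_combination hu2) (by linear_combination hv2)
  norm_num at e3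

/-! ### Pairs of roots with a fixed logarithmic derivative -/

/-- The normalized sum of the roots. -/
noncomputable def rootSum (N X : ℂ) : ℂ := 2 * N / (2 * N + 1) + (2 * N + 2) / (2 * N + 1) * X

theorem one_sub_rootSum_add {N : ℂ} (X : ℂ) (hN : 2 * N + 1 ≠ 0) :
    1 - rootSum N X + X = (1 - X) / (2 * N + 1) := by
  unfold rootSum
  field_simp
  ring

/-- This relation characterizes `rootSum`: it says that the logarithmic derivative of x² - Px + X at
x = 1 equals 2N + 2. -/
theorem two_sub_rootSum {N : ℂ} (X : ℂ) (hN : 2 * N + 1 ≠ 0) :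
    2 - rootSum N X = (2 * N + 2) * (1 - rootSum N X + X) := by
  unfold rootSum
  field_simp
  ring

/-- Used to exclude double roots: only X = 1 and X = (N/(N+1))² produce them. The second value is
that of colour r, where the quadratic is a square. -/
theorem discrim_rootSum {N : ℂ} (X : ℂ) (hN : 2 * N + 1 ≠ 0) (hN' : N + 1 ≠ 0) :
    rootSum N X ^ 2 - 4 * X =
      ((2 * N + 2) / (2 * N + 1)) ^ 2 * (X - 1) * (X - (N / (N + 1)) ^ 2) := by
  unfold rootSum
  field_simp
  ring

theorem rootSum_sq {N : ℂ} (hN : 2 * N + 1 ≠ 0) (hN' : N + 1 ≠ 0) :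
    rootSum N ((N / (N + 1)) ^ 2) = 2 * (N / (N + 1)) := by
  unfold rootSum
  field_simp
  ring

/-- At x = c, the identity and its derivative have left sides c y(c) and (μ+2) y(c). Eliminating
y(c), and using that y₊'/y₊ equals (2N+2)/c at c, leaves a linear relation between c and c₀. The
proof carries out an equivalent elimination on coefficients. -/
theorem IsReflection.mul_eq {μ N c₀ c p q P' Q' : ℂ}
    (h : IsReflection μ c₀ c p q (c * P') (c ^ 2 * Q')) (hμ : μ ≠ 0) (hc : c ≠ 0)
    (hD : 1 - P' + Q' ≠ 0) (hI : 2 - P' = (2 * N + 2) * (1 - P' + Q')) :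
    (2 * N - μ + 1) * c = (2 * N - μ) * c₀ := by
  have hq : (μ + 1) * q = μ * c * Q' * c₀ :=
    mul_right_cancel₀ hc (by linear_combination h.const)
  have h1 : μ * c * ((2 * N - μ + 1) * c * (1 - P' + Q')) =
      μ * c * ((2 * N - μ) * c₀ * (1 - P' + Q')) := by
    linear_combination (μ + 1) * h.lin - (μ + 2) * hq - μ * c * h.quad +
      μ * c * (c₀ - c) * hI
  have h2 := mul_left_cancel₀ (mul_ne_zero hμ hc) h1
  exact mul_right_cancel₀ hD h2

/-- The solution of the reflection identity. -/
theorem isReflection_iff {μ N c₀ c p q X v w : ℂ} (hμ : μ ≠ 0) (hμ1 : μ + 1 ≠ 0)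
    (hN : 2 * N + 1 ≠ 0) (hv : 2 * N - μ + 1 ≠ 0) (hc₀ : c₀ ≠ 0) (hv0 : v ≠ 0)
    (hve : v = (2 * N - μ) / (2 * N - μ + 1)) (hwe : w = μ / (μ + 1)) (hc : c = v * c₀) :
    IsReflection μ c₀ c p q (c * rootSum N X) (c ^ 2 * X) ↔
      p = c₀ * rootSum N (v * w * X) ∧ q = c₀ ^ 2 * (v * w * X) := by
  have hv' : (2 * N - μ + 1) * v = 2 * N - μ := by rw [hve]; field_simp
  have hw' : (μ + 1) * w = μ := by rw [hwe]; field_simp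
  have hr : ∀ Y, (2 * N + 1) * rootSum N Y = 2 * N + (2 * N + 2) * Y := fun Y => by
    unfold rootSum; field_simp
  subst hc
  have e1 := hr X
  have e2 := hr (v * w * X)
  constructor
  · intro h
    constructor
    · refine mul_left_cancel₀ hN (mul_left_cancel₀ hμ1 ?_)
      linear_combination (2 * N + 1) * h.quad + μ * v * c₀ * e1 - (μ + 1) * c₀ * e2 +
        c₀ * hv' - (2 * N + 2) * c₀ * v * X * hw'
    · refine mul_left_cancel₀ hμ1 (mul_right_cancel₀ (mul_ne_zero hv0 hc₀) ?_)
      linear_combination h.const - c₀ ^ 3 * v ^ 2 * X * hw'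
  · rintro ⟨rfl, rfl⟩
    have a1 : (μ + 1) * (c₀ * rootSum N (v * w * X)) + (μ - 1) * (v * c₀) =
        μ * (c₀ + v * c₀ * rootSum N X) := by
      refine mul_left_cancel₀ hN ?_
      linear_combination - μ * v * c₀ * e1 + (μ + 1) * c₀ * e2 -
        c₀ * hv' + (2 * N + 2) * c₀ * v * X * hw'
    refine ⟨a1, ?_, by linear_combination c₀ ^ 3 * v ^ 2 * X * hw'⟩
    refine mul_left_cancel₀ hN (mul_left_cancel₀ hμ1 ?_)
    linear_combination c₀ ^ 2 * v * ((2 * N + 1) * (μ + 2) * X * hw' +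
      μ * (2 * N + 2) * v * X * hw' + μ * (μ + 1) * (e2 - e1) - μ * X * hv')

/-! ### Pairs of roots for the colors `n < k < r` -/

/-- The tuple `y` has the form `(…, x - s, x² - p x + q, …, x² - p x + q, x - g, 1)`, the first
displayed entry being of color `n` and the last but one of color `r`. -/
structure IsPairTuple (n r : ℕ) (y : ℕ → ℂ[X]) (s g : ℂ) (p q : ℕ → ℂ) : Prop where
  prev : y n = X - C s
  pair : ∀ k, n < k → k < r → y k = X ^ 2 - C (p k) * X + C (q k)
  last : y r = X - C g
  next : y (r + 1) = 1
  p_last : p r = 2 * g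
  q_last : q r = g ^ 2

/-- The Bethe ansatz equation of the colors `n < k ≤ r` in terms of coefficients. -/
structure PairEquations (n r : ℕ) (L : ℕ → ℕ) (s g : ℂ) (p q : ℕ → ℂ) : Prop where
  first : ∀ x, x ^ 2 - p (n + 1) * x + q (n + 1) = 0 → (L (n + 1) ≠ 0 → x ≠ 0) ∧ x ≠ s ∧
    x ^ 2 - p (n + 2) * x + q (n + 2) ≠ 0 ∧ 2 * x - p (n + 1) ≠ 0 ∧
    2 / (2 * x - p (n + 1)) = L (n + 1) / x + 1 / (x - s) +
      (2 * x - p (n + 2)) / (x ^ 2 - p (n + 2) * x + q (n + 2))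
  middle : ∀ k, n < k → k + 1 < r → ∀ x, x ^ 2 - p (k + 1) * x + q (k + 1) = 0 →
    (L (k + 1) ≠ 0 → x ≠ 0) ∧ x ^ 2 - p k * x + q k ≠ 0 ∧
    x ^ 2 - p (k + 2) * x + q (k + 2) ≠ 0 ∧ 2 * x - p (k + 1) ≠ 0 ∧
    2 / (2 * x - p (k + 1)) = L (k + 1) / x + (2 * x - p k) / (x ^ 2 - p k * x + q k) +
      (2 * x - p (k + 2)) / (x ^ 2 - p (k + 2) * x + q (k + 2))
  last : ∀ k, k + 1 = r → (L r ≠ 0 → g ≠ 0) ∧ g ^ 2 - p k * g + q k ≠ 0 ∧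
    0 = L r / g + (2 * g - p k) / (g ^ 2 - p k * g + q k)

/-- For k + 1 = r the multiplicity 2 is absorbed by the square: (x - g)² is the quadratic with
coefficients `p r`, `q r`, so the last link looks like all the others. -/
theorem IsPairTuple.next_iff {n r : ℕ} {y : ℕ → ℂ[X]} {s g : ℂ} {p q : ℕ → ℂ}
    (h : IsPairTuple n r y s g p q) {k : ℕ} (hk : n < k + 1) (hkr : k + 1 ≤ r) (x : ℂ) :
    ((y (k + 1)).eval x ≠ 0 ↔ x ^ 2 - p (k + 1) * x + q (k + 1) ≠ 0) ∧
      ((y (k + 1)).eval x ≠ 0 →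
        nextMult r k * ((y (k + 1)).derivative.eval x / (y (k + 1)).eval x) =
          (2 * x - p (k + 1)) / (x ^ 2 - p (k + 1) * x + q (k + 1))) := by
  rcases hkr.lt_or_eq with hlt | rfl
  · rw [h.pair _ hk hlt, nextMult, if_neg (by omega)]
    simp [one_add_one_eq_two]
  · rw [h.last, nextMult, if_pos rfl, h.p_last, h.q_last]
    have e : x ^ 2 - 2 * g * x + g ^ 2 = (x - g) ^ 2 := by ring
    rw [e]
    refine ⟨by simp, fun hx => ?_⟩
    simp only [eval_sub, eval_X, eval_C, derivative_sub, derivative_X, derivative_C, sub_zero,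
      eval_one] at hx ⊢
    field_simp

theorem IsPairTuple.critical_iff {n r : ℕ} {L : ℕ → ℕ} {y : ℕ → ℂ[X]} {s g : ℂ} {p q : ℕ → ℂ}
    (h : IsPairTuple n r y s g p q) (hnr : n + 1 < r) :
    (∀ k, n < k → k ≤ r → ∀ x, (y k).eval x = 0 →
      IsCriticalAt (L k) (nextMult r k) (y (k - 1)) (y k) (y (k + 1)) x) ↔
      PairEquations n r L s g p q := by
  have hev : ∀ k, n < k → k < r → ∀ x, (y k).eval x = x ^ 2 - p k * x + q k := by
    intro k h1 h2 x
    simp [h.pair k h1 h2]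
  have hd : ∀ k, n < k → k < r → ∀ x, (y k).derivative.eval x = 2 * x - p k := by
    intro k h1 h2 x
    simp [h.pair k h1 h2, one_add_one_eq_two]
  have hdd : ∀ k, n < k → k < r → ∀ x, (y k).derivative.derivative.eval x = 2 := by
    intro k h1 h2 x
    simp [h.pair k h1 h2, one_add_one_eq_two]
  constructor
  · intro H
    refine ⟨fun x hx => ?_, fun k hk hkr x hx => ?_, fun k hk => ?_⟩
    · have H1 := H (n + 1) (by omega) (by omega) x (by rw [hev _ (by omega) hnr, hx])
      have h2 := H1.eqn
      rw [(h.next_iff (by omega) (by omega) x).2 H1.next, hdd _ (by omega) hnr,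
        hd _ (by omega) hnr] at h2
      have h3 := H1.prev
      have h4 := H1.simple
      rw [hd _ (by omega) hnr] at h4
      simp only [Nat.add_sub_cancel, h.prev, eval_sub, eval_X, eval_C, derivative_sub,
        derivative_X, derivative_C, sub_zero, eval_one] at h2 h3
      exact ⟨fun h0 => H1.ne_zero (by exact_mod_cast h0), sub_ne_zero.1 h3,
        (h.next_iff (by omega) (by omega) x).1.1 H1.next, h4, h2⟩
    · have H1 := H (k + 1) (by omega) (by omega) x (by rw [hev _ (by omega) hkr, hx])
      have h2 := H1.eqn
      rw [(h.next_iff (by omega) (by omega) x).2 H1.next, hdd _ (by omega) hkr,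
        hd _ (by omega) hkr] at h2
      have h3 := H1.prev
      have h4 := H1.simple
      rw [hd _ (by omega) hkr] at h4
      rw [Nat.add_sub_cancel, hev k hk (by omega)] at h3 h2
      rw [hd k hk (by omega)] at h2
      exact ⟨fun h0 => H1.ne_zero (by exact_mod_cast h0), h3,
        (h.next_iff (by omega) (by omega) x).1.1 H1.next, h4, h2⟩
    · subst hk
      have H1 := H (k + 1) (by omega) (by omega) g (by rw [h.last]; simp)
      have h3 := H1.prev
      have h2 := H1.eqn
      rw [Nat.add_sub_cancel, hev k (by omega) (by omega)] at h2 h3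
      rw [hd k (by omega) (by omega), h.last, h.next] at h2
      simp only [derivative_sub, derivative_X, derivative_C, sub_zero, derivative_one, eval_zero,
        zero_div, mul_zero, add_zero] at h2
      exact ⟨fun h0 => H1.ne_zero (by exact_mod_cast h0), h3, h2⟩
  · intro H k hk hkr x hx
    obtain ⟨k, rfl⟩ : ∃ j, k = j + 1 := ⟨k - 1, by omega⟩
    rcases hkr.lt_or_eq with hlt | rfl
    · rw [hev _ hk hlt] at hx
      rcases (Nat.lt_succ_iff.1 hk).lt_or_eq with hnk | rfl
      · obtain ⟨h1, h2, h3, h4, h5⟩ := H.middle k hnk hlt x hx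
        have h6 := (h.next_iff (by omega) (by omega) x).1.2 h3
        refine ⟨fun h0 => h1 (by exact_mod_cast h0), ?_, h6, ?_, ?_⟩
        · rwa [Nat.add_sub_cancel, hev k hnk (by omega)]
        · rwa [hd _ hk hlt]
        · rw [(h.next_iff (by omega) (by omega) x).2 h6, hdd _ hk hlt, hd _ hk hlt,
            Nat.add_sub_cancel, hev k hnk (by omega), hd k hnk (by omega), h5]
      · obtain ⟨h1, h2, h3, h4, h5⟩ := H.first x hx
        have h6 := (h.next_iff (by omega) (by omega) x).1.2 h3
        refine ⟨fun h0 => h1 (by exact_mod_cast h0), ?_, h6, ?_, ?_⟩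
        · simpa [h.prev, sub_ne_zero] using h2
        · rwa [hd _ hk hlt]
        · rw [(h.next_iff (by omega) (by omega) x).2 h6, hdd _ hk hlt, hd _ hk hlt,
            Nat.add_sub_cancel, h.prev, h5]
          simp
    · obtain rfl : x = g := by
        rw [h.last] at hx
        simpa [sub_eq_zero] using hx
      obtain ⟨h1, h2, h3⟩ := H.last k rfl
      refine ⟨fun h0 => h1 (by exact_mod_cast h0), ?_, ?_, ?_, ?_⟩
      · rwa [Nat.add_sub_cancel, hev k (by omega) (by omega)]
      · simp [h.next]
      · simp [h.last]
      · rw [Nat.add_sub_cancel, hev k (by omega) (by omega), hd k (by omega) (by omega),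
          h.last, h.next]
        simpa using h3

/-! ### The ratios in the explicit formulas -/

/-- The number `⟨λ, α_m^∨ + … + α_k^∨⟩ + k - m`. -/
def shiftedSum (L : ℕ → ℕ) (m k : ℕ) : ℕ := ∑ i ∈ Finset.Icc m k, L i + (k - m)

theorem shiftedSum_self (L : ℕ → ℕ) (m : ℕ) : shiftedSum L m m = L m := by simp [shiftedSum]

theorem shiftedSum_succ (L : ℕ → ℕ) {m k : ℕ} (h : m ≤ k) :
    shiftedSum L m (k + 1) = shiftedSum L m k + L (k + 1) + 1 := by
  rw [shiftedSum, Finset.sum_Icc_succ_top (by omega), shiftedSum]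
  omega

theorem shiftedSum_mono (L : ℕ → ℕ) {m k k' : ℕ} (h : m ≤ k) (h' : k ≤ k') :
    shiftedSum L m k ≤ shiftedSum L m k' := by
  induction k', h' using Nat.le_induction with
  | base => exact le_rfl
  | succ k' hk ih =>
    rw [shiftedSum_succ L (h.trans hk)]
    omega

/-- The ratio of consecutive roots `c_k`. -/
noncomputable def rootRatio (N μ : ℕ) : ℝ := (2 * N - μ) / (2 * N - μ + 1)

/-- The ratio `μ / (μ + 1)`. -/
noncomputable def weightRatio (μ : ℕ) : ℝ := μ / (μ + 1)

/-- The normalized product of the two roots of color `k`. -/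
noncomputable def rootProduct (L : ℕ → ℕ) (m r k : ℕ) : ℝ :=
  ∏ i ∈ Finset.Icc k r,
    rootRatio (shiftedSum L m r) (shiftedSum L m i) * weightRatio (shiftedSum L m i)

theorem rootRatio_self (N : ℕ) : rootRatio N N = weightRatio N := by
  unfold rootRatio weightRatio
  congr 1 <;> ring

theorem rootRatio_mem {N μ : ℕ} (h : 1 ≤ μ) (h' : μ ≤ N) :
    0 < rootRatio N μ ∧ rootRatio N μ < 1 := by
  have h1 : (1 : ℝ) ≤ μ := by exact_mod_cast h
  have h2 : (μ : ℝ) ≤ N := by exact_mod_cast h'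
  unfold rootRatio
  refine ⟨div_pos (by linarith) (by linarith), ?_⟩
  rw [div_lt_one (by linarith)]
  linarith

theorem weightRatio_mem {μ : ℕ} (h : 1 ≤ μ) : 0 < weightRatio μ ∧ weightRatio μ < 1 := by
  have h1 : (1 : ℝ) ≤ μ := by exact_mod_cast h
  unfold weightRatio
  refine ⟨div_pos (by linarith) (by linarith), ?_⟩
  rw [div_lt_one (by linarith)]
  linarith

theorem rootProduct_self (L : ℕ → ℕ) (m r : ℕ) :
    rootProduct L m r r = weightRatio (shiftedSum L m r) ^ 2 := by
  simp [rootProduct, rootRatio_self, sq]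

theorem rootProduct_eq (L : ℕ → ℕ) (m : ℕ) {r k : ℕ} (h : k < r) :
    rootProduct L m r k = rootRatio (shiftedSum L m r) (shiftedSum L m k) *
      weightRatio (shiftedSum L m k) * rootProduct L m r (k + 1) := by
  unfold rootProduct
  rw [← Finset.insert_Icc_add_one_left_eq_Icc h.le, Finset.prod_insert (by simp)]

/-- Each factor lies strictly between 0 and 1, and the factor of index r alone is (N/(N+1))². These
bounds keep the product away from both values where the discriminant vanishes; the ratios are real
so that they can be compared. -/
theorem rootProduct_mem {L : ℕ → ℕ} {m r : ℕ} (hL : 1 ≤ L m) {k : ℕ} (hk : m ≤ k)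
    (hkr : k ≤ r) : 0 < rootProduct L m r k ∧ rootProduct L m r k < 1 ∧
      (k < r → rootProduct L m r k < weightRatio (shiftedSum L m r) ^ 2) := by
  have hM : ∀ i, m ≤ i → 1 ≤ shiftedSum L m i := fun i hi => by
    have := shiftedSum_mono L le_rfl hi
    rw [shiftedSum_self] at this
    omega
  induction hkr using Nat.decreasingInduction with
  | self =>
    have := weightRatio_mem (hM r hk)
    rw [rootProduct_self]
    refine ⟨pow_pos this.1 2, ?_, fun h => absurd h (lt_irrefl _)⟩
    exact pow_lt_one₀ this.1.le this.2 two_ne_zero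
  | of_succ k hkr ih =>
    obtain ⟨h1, h2, h3⟩ := ih (by omega)
    have hv := rootRatio_mem (hM k hk) (shiftedSum_mono L hk hkr.le)
    have hw := weightRatio_mem (hM k hk)
    have h4 : rootRatio (shiftedSum L m r) (shiftedSum L m k) *
        weightRatio (shiftedSum L m k) < 1 := mul_lt_one_of_nonneg_of_lt_one_left hv.1.le hv.2 hw.2.le
    have h5 := mul_pos hv.1 hw.1
    have h6 : rootProduct L m r k < rootProduct L m r (k + 1) := by
      rw [rootProduct_eq L m hkr]
      exact mul_lt_of_lt_one_left h1 h4
    refine ⟨?_, h6.trans h2, fun _ => ?_⟩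
    · rw [rootProduct_eq L m hkr]
      positivity
    · rcases (Nat.succ_le_of_lt hkr).lt_or_eq with h | h
      · exact h6.trans (h3 h)
      · have h7 := rootProduct_self L m r
        rw [Nat.succ_eq_add_one] at h
        rw [h] at h6
        rwa [h7] at h6

/-- The root `c_k` of the reflected polynomial, `k ≥ n`. -/
noncomputable def reflectedRoot (L : ℕ → ℕ) (s : ℂ) (n r k : ℕ) : ℂ :=
  s * ∏ i ∈ Finset.Ioc n k,
    (rootRatio (shiftedSum L (n + 1) r) (shiftedSum L (n + 1) i) : ℂ)

theorem reflectedRoot_self (L : ℕ → ℕ) (s : ℂ) (n r : ℕ) : reflectedRoot L s n r n = s := by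
  simp [reflectedRoot]

theorem reflectedRoot_succ (L : ℕ → ℕ) (s : ℂ) (r : ℕ) {n k : ℕ} (h : n ≤ k) :
    reflectedRoot L s n r (k + 1) =
      rootRatio (shiftedSum L (n + 1) r) (shiftedSum L (n + 1) (k + 1)) *
        reflectedRoot L s n r k := by
  unfold reflectedRoot
  rw [Finset.prod_Ioc_succ_top h]
  ring

/-! ### Reflecting solutions colour by colour -/

theorem logDeriv_eq_of_reflection {ν x c d Q : ℂ} (hx : x ≠ 0) (hc : x ≠ c) (hQ : Q ≠ 0)
    (h : (ν + 1) * Q * (x - c) + x * (Q - d * (x - c)) = 0) :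
    d / Q = (ν + 1) / x + 1 / (x - c) := by
  have hc' := sub_ne_zero.2 hc
  field_simp
  linear_combination -h

/-- Solutions of the Bethe ansatz equation admit successive reflections. -/
theorem PairEquations.exists_isReflection {n r : ℕ} {L : ℕ → ℕ} {s g : ℂ} {p q : ℕ → ℂ}
    (H : PairEquations n r L s g p q) (hL : 1 ≤ L (n + 1)) (hnr : n + 1 < r) :
    ∃ c : ℕ → ℂ, c n = s ∧ ∀ k, n ≤ k → k + 1 < r →
      IsReflection (shiftedSum L (n + 1) (k + 1)) (c k) (c (k + 1)) (p (k + 1)) (q (k + 1))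
        (p (k + 2)) (q (k + 2)) := by
  have hM : ∀ k, n ≤ k → (shiftedSum L (n + 1) (k + 1) : ℂ) ≠ 0 := fun k hk => by
    have := shiftedSum_mono L (le_refl (n + 1)) (Nat.succ_le_succ hk)
    rw [shiftedSum_self] at this
    simp only [Nat.succ_eq_add_one] at this
    exact_mod_cast (by omega : shiftedSum L (n + 1) (k + 1) ≠ 0)
  suffices h : ∀ K, n ≤ K → K + 1 ≤ r → ∃ c : ℕ → ℂ, c n = s ∧ ∀ k, n ≤ k → k < K →
      IsReflection (shiftedSum L (n + 1) (k + 1)) (c k) (c (k + 1)) (p (k + 1)) (q (k + 1))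
        (p (k + 2)) (q (k + 2)) by
    obtain ⟨c, hc, h⟩ := h (r - 1) (by omega) (by omega)
    exact ⟨c, hc, fun k h1 h2 => h k h1 (by omega)⟩
  intro K hK
  induction K, hK using Nat.le_induction with
  | base => exact fun _ => ⟨fun _ => s, rfl, fun k h1 h2 => absurd h1 (by omega)⟩
  | succ K hK ih =>
    intro hKr
    obtain ⟨c, hcn, hc⟩ := ih (by omega)
    have key : ∃ c', IsReflection (shiftedSum L (n + 1) (K + 1)) (c K) c' (p (K + 1)) (q (K + 1))
        (p (K + 2)) (q (K + 2)) := by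
      rcases hK.lt_or_eq with hnK | rfl
      · refine Gaudin.exists_isReflection (hM K hK) (fun x hx => (H.middle K hnK hKr x hx).2.2.2.1)
          fun x hx => ?_
        obtain ⟨h1, h2, h3, h4, h5⟩ := H.middle K hnK hKr x hx
        obtain ⟨j, rfl⟩ : ∃ j, K = j + 1 := ⟨K - 1, by omega⟩
        have hrefl := (hc j (by omega) (by omega)).eval x
        have hx' : x ^ 2 - p (j + 2) * x + q (j + 2) = 0 := hx
        rw [hx', mul_zero] at hrefl
        refine exists_interpolation_value h4 ?_
        have hpos : (shiftedSum L (n + 1) (j + 1) : ℂ) + 1 ≠ 0 := Nat.cast_add_one_ne_zero _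
        -- A colour of weight 0 may a priori have the root 0. The previous identity then forces c =
        -- 0 as well, which is the degenerate case of the interpolation.
        by_cases hx0 : x = 0
        · left
          refine ⟨hx0, ?_⟩
          rw [hx0, zero_mul, add_zero] at hrefl
          rw [hx0] at h2
          have := (mul_eq_zero.1 hrefl).resolve_left (mul_ne_zero hpos h2)
          rw [hx0]
          exact sub_eq_zero.1 this
        · right
          have hxc : x ≠ c (j + 1) := by
            intro hxc
            rw [← hxc, sub_self, mul_zero, mul_zero, sub_zero, zero_add] at hrefl
            exact mul_ne_zero hx0 h2 hrefl
          refine ⟨hx0, hxc, h3, ?_⟩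
          -- Replacing the previous logarithmic derivative adds μ + 1 to the weight, which is the
          -- recursion of `shiftedSum`.
          rw [h5, logDeriv_eq_of_reflection hx0 hxc h2 hrefl,
            shiftedSum_succ L (by omega : n + 1 ≤ j + 1)]
          push_cast
          ring
      · refine Gaudin.exists_isReflection (hM n hK) (fun x hx => (H.first x hx).2.2.2.1)
          fun x hx => ?_
        obtain ⟨h1, h2, h3, h4, h5⟩ := H.first x hx
        refine exists_interpolation_value h4 (Or.inr ⟨h1 (by omega), ?_, h3, ?_⟩)
        · rwa [hcn]
        · rw [h5, hcn, shiftedSum_self]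
    obtain ⟨c', hc'⟩ := key
    refine ⟨Function.update c (K + 1) c', ?_, fun k h1 h2 => ?_⟩
    · rw [Function.update_of_ne (by omega), hcn]
    · rw [Function.update_of_ne (by omega)]
      rcases (Nat.lt_succ_iff.1 h2).lt_or_eq with h | rfl
      · rw [Function.update_of_ne (by omega)]
        exact hc k h1 h
      · rwa [Function.update_self]

theorem shiftedSum_facts {L : ℕ → ℕ} {n r k : ℕ} (hL : 1 ≤ L (n + 1)) (hk : n ≤ k)
    (hkr : k + 1 ≤ r) : 1 ≤ shiftedSum L (n + 1) (k + 1) ∧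
      (shiftedSum L (n + 1) (k + 1) : ℂ) ≠ 0 ∧ (shiftedSum L (n + 1) (k + 1) : ℂ) + 1 ≠ 0 ∧
      (2 : ℂ) * shiftedSum L (n + 1) r - shiftedSum L (n + 1) (k + 1) + 1 ≠ 0 ∧
      (rootRatio (shiftedSum L (n + 1) r) (shiftedSum L (n + 1) (k + 1)) : ℂ) ≠ 0 := by
  have h1 := shiftedSum_mono L (le_refl (n + 1)) (Nat.succ_le_succ hk)
  rw [shiftedSum_self, Nat.succ_eq_add_one] at h1
  have h2 := shiftedSum_mono L (Nat.succ_le_succ hk) hkr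
  rw [Nat.succ_eq_add_one, Nat.succ_eq_add_one] at h2
  refine ⟨by omega, by exact_mod_cast (by omega : shiftedSum L (n + 1) (k + 1) ≠ 0),
    Nat.cast_add_one_ne_zero _, ?_, ?_⟩
  · obtain ⟨d, hd⟩ := Nat.exists_eq_add_of_le h2
    rw [hd]
    have : (2 : ℂ) * ((shiftedSum L (n + 1) (k + 1) + d : ℕ) : ℂ) -
        shiftedSum L (n + 1) (k + 1) + 1 = ((shiftedSum L (n + 1) (k + 1) + 2 * d + 1 : ℕ) : ℂ) := by
      push_cast
      ring
    rw [this]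
    exact Nat.cast_ne_zero.2 (Nat.succ_ne_zero _)
  · exact_mod_cast (rootRatio_mem (h1.trans' hL) h2).1.ne'

theorem two_mul_natCast_add_one_ne_zero (N : ℕ) : (2 : ℂ) * N + 1 ≠ 0 := by
  have := Nat.cast_add_one_ne_zero (R := ℂ) (2 * N)
  push_cast at this
  exact this

theorem natCast_add_two_ne_zero (N : ℕ) : (N : ℂ) + 2 ≠ 0 := by
  have := Nat.cast_ne_zero (R := ℂ).2 (Nat.succ_ne_zero (N + 1))
  push_cast at this
  exact fun h => this (by linear_combination h)

theorem one_sub_rootSum_add_ne_zero {L : ℕ → ℕ} {n r k : ℕ} (hL : 1 ≤ L (n + 1)) (hk : n ≤ k)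
    (hkr : k + 1 ≤ r) :
    1 - rootSum (shiftedSum L (n + 1) r) (rootProduct L (n + 1) r (k + 1)) +
      rootProduct L (n + 1) r (k + 1) ≠ 0 := by
  rw [one_sub_rootSum_add _ (two_mul_natCast_add_one_ne_zero _)]
  refine div_ne_zero (sub_ne_zero.2 ?_) (two_mul_natCast_add_one_ne_zero _)
  exact_mod_cast (rootProduct_mem hL (by omega : n + 1 ≤ k + 1) hkr).2.1.ne'

/-- The coefficients of the explicit solution. -/
structure IsExplicitPair (n r : ℕ) (L : ℕ → ℕ) (s g : ℂ) (p q : ℕ → ℂ) : Prop where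
  sum : ∀ k, n ≤ k → k + 1 ≤ r → p (k + 1) = reflectedRoot L s n r k *
    rootSum (shiftedSum L (n + 1) r) (rootProduct L (n + 1) r (k + 1))
  prod : ∀ k, n ≤ k → k + 1 ≤ r →
    q (k + 1) = reflectedRoot L s n r k ^ 2 * rootProduct L (n + 1) r (k + 1)
  last : g = reflectedRoot L s n r r

theorem PairEquations.one_le {n r : ℕ} {L : ℕ → ℕ} {s g : ℂ} {p q : ℕ → ℂ}
    (H : PairEquations n r L s g p q) : 1 ≤ L (n + 1) := by
  by_contra h
  have h0 : L (n + 1) = 0 := by omega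
  refine not_critical_of_weight_zero (p := p (n + 1)) (q := q (n + 1)) (s := s) (p' := p (n + 2))
    (q' := q (n + 2)) fun x hx => ?_
  obtain ⟨h1, h2, h3, h4, h5⟩ := H.first x hx
  refine ⟨h4, h2, h3, ?_⟩
  rw [h5, h0]
  simp

/-- The reflections run upwards from colour n + 1, but the unknown c_k become explicit only
downwards, starting from colour r. -/
theorem PairEquations.isExplicitPair {n r : ℕ} {L : ℕ → ℕ} {s g : ℂ} {p q : ℕ → ℂ}
    (H : PairEquations n r L s g p q) (hnr : n + 1 < r) (hp : p r = 2 * g) (hq : q r = g ^ 2) :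
    s ≠ 0 ∧ IsExplicitPair n r L s g p q := by
  have hL := H.one_le
  obtain ⟨c, hcn, hc⟩ := H.exists_isReflection hL hnr
  -- At g the right side of the identity of colour r - 1 vanishes, because y_r² does. With the
  -- equation of colour r this gives N(g - c) + g = 0. If c were 0, then g = 0 would also be a root
  -- of y_{r-1}, which is excluded.
  have hlast : c (r - 1) ≠ 0 ∧
      (shiftedSum L (n + 1) r + 1 : ℂ) * g = shiftedSum L (n + 1) r * c (r - 1) := by
    obtain ⟨j, rfl⟩ : ∃ j, r = j + 2 := ⟨r - 2, by omega⟩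
    obtain ⟨h1, h2, h3⟩ := H.last (j + 1) rfl
    have hR := hc j (by omega) (by omega)
    have he := hR.eval g
    rw [hp, hq] at he
    have hmul : L (j + 2) * (g ^ 2 - p (j + 1) * g + q (j + 1)) + g * (2 * g - p (j + 1)) = 0 := by
      by_cases hg : g = 0
      · have : L (j + 2) = 0 := by
          by_contra h
          exact h1 h hg
        rw [this, hg]
        simp
      · generalize g ^ 2 - p (j + 1) * g + q (j + 1) = Q at h2 h3 ⊢
        field_simp at h3
        linear_combination -h3
    have hgc : (shiftedSum L (n + 1) (j + 2) + 1 : ℂ) * g =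
        shiftedSum L (n + 1) (j + 2) * c (j + 1) := by
      rw [shiftedSum_succ L (by omega : n + 1 ≤ j + 1)]
      push_cast
      refine mul_left_cancel₀ h2 ?_
      linear_combination he + (g - c (j + 1)) * hmul
    refine ⟨fun h0 => ?_, hgc⟩
    simp only [show j + 2 - 1 = j + 1 from rfl] at h0
    rw [h0, mul_zero] at hgc
    have hg : g = 0 := (mul_eq_zero.1 hgc).resolve_left (Nat.cast_add_one_ne_zero _)
    have hl := hR.lin
    rw [hp, hq, h0, hg] at hl
    refine h2 ?_
    rw [hg]
    have h2' := natCast_add_two_ne_zero (shiftedSum L (n + 1) (j + 1))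
    have : (shiftedSum L (n + 1) (j + 1) + 2 : ℂ) * q (j + 1) = 0 := by linear_combination hl
    rw [(mul_eq_zero.1 this).resolve_left h2']
    ring
  have hN := two_mul_natCast_add_one_ne_zero (shiftedSum L (n + 1) r)
  have hN1 : (shiftedSum L (n + 1) r : ℂ) + 1 ≠ 0 := Nat.cast_add_one_ne_zero _
  have hgw : g = weightRatio (shiftedSum L (n + 1) r) * c (r - 1) := by
    unfold weightRatio
    push_cast
    field_simp
    linear_combination hlast.2
  -- Downward induction from k = r - 1, where the pair is the double root g. Each step first finds
  -- the ratio c_{k+1}/c_k from the logarithmic derivative, then solves the identity for y_{k+1}.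
  have key : ∀ k, k ≤ r - 1 → n ≤ k → c k ≠ 0 ∧
      p (k + 1) = c k * rootSum (shiftedSum L (n + 1) r) (rootProduct L (n + 1) r (k + 1)) ∧
      q (k + 1) = c k ^ 2 * rootProduct L (n + 1) r (k + 1) ∧
      (k < r - 1 → c (k + 1) =
        rootRatio (shiftedSum L (n + 1) r) (shiftedSum L (n + 1) (k + 1)) * c k) := by
    intro k hk
    induction hk using Nat.decreasingInduction with
    | self =>
      intro _
      have hr1 : r - 1 + 1 = r := by omega
      rw [hr1, rootProduct_self, hp, hq]
      refine ⟨hlast.1, ?_, ?_, fun h => absurd h (lt_irrefl _)⟩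
      · have := rootSum_sq hN hN1
        rw [hgw]
        unfold weightRatio
        push_cast
        rw [this]
        ring
      · rw [hgw]
        push_cast
        ring
    | of_succ k hkr ih =>
      intro hnk
      obtain ⟨h1, h2, h3, -⟩ := ih (by omega)
      obtain ⟨-, f1, f2, f3, f4⟩ := shiftedSum_facts (r := r) hL hnk (by omega)
      have hR := hc k hnk (by omega)
      rw [h2, h3] at hR
      have hm := hR.mul_eq f1 h1 (one_sub_rootSum_add_ne_zero hL (by omega) (by omega))
        (two_sub_rootSum _ hN)
      have hck : c k ≠ 0 := by
        intro h0
        rw [h0, mul_zero] at hm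
        exact mul_ne_zero f3 h1 hm
      have hcv : c (k + 1) =
          rootRatio (shiftedSum L (n + 1) r) (shiftedSum L (n + 1) (k + 1)) * c k := by
        unfold rootRatio
        push_cast
        field_simp
        linear_combination hm
      obtain ⟨h5, h6⟩ := (isReflection_iff (w := weightRatio (shiftedSum L (n + 1) (k + 1)))
        f1 f2 hN f3 hck f4 (by unfold rootRatio; push_cast; rfl)
        (by unfold weightRatio; push_cast; rfl) hcv).1 hR
      refine ⟨hck, ?_, ?_, fun _ => hcv⟩
      · rw [h5, rootProduct_eq L _ (by omega : k + 1 < r)]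
        push_cast
        rfl
      · rw [h6, rootProduct_eq L _ (by omega : k + 1 < r)]
        push_cast
        rfl
  have hcr : ∀ k, n ≤ k → k ≤ r - 1 → c k = reflectedRoot L s n r k := by
    intro k hk
    induction k, hk using Nat.le_induction with
    | base => exact fun _ => by rw [reflectedRoot_self, hcn]
    | succ k hk ih =>
      intro hkr
      rw [(key k (by omega) hk).2.2.2 (by omega), reflectedRoot_succ L s r hk, ih (by omega)]
  refine ⟨?_, fun k h1 h2 => ?_, fun k h1 h2 => ?_, ?_⟩
  · rw [← hcn]
    exact (key n (by omega) le_rfl).1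
  · rw [← hcr k h1 (by omega)]
    exact (key k (by omega) h1).2.1
  · rw [← hcr k h1 (by omega)]
    exact (key k (by omega) h1).2.2.1
  · rw [hgw, hcr _ (by omega) le_rfl, ← rootRatio_self]
    obtain ⟨j, rfl⟩ : ∃ j, r = j + 1 := ⟨r - 1, by omega⟩
    exact (reflectedRoot_succ L s (j + 1) (by omega : n ≤ j)).symm

theorem reflectedRoot_ne_zero {L : ℕ → ℕ} {s : ℂ} {n r : ℕ} (hL : 1 ≤ L (n + 1)) (hs : s ≠ 0)
    {k : ℕ} (hk : n ≤ k) : k ≤ r → reflectedRoot L s n r k ≠ 0 := by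
  induction k, hk using Nat.le_induction with
  | base => exact fun _ => by rwa [reflectedRoot_self]
  | succ k hk ih =>
    intro hkr
    rw [reflectedRoot_succ L s r hk]
    exact mul_ne_zero (shiftedSum_facts hL hk hkr).2.2.2.2 (ih (by omega))

theorem logDeriv_eq_of_reflection_at_root {μ x c₀ u d Q Q' : ℂ} (hx : x ≠ 0) (hc : x ≠ c₀)
    (hQ : Q ≠ 0) (hd : d ≠ 0) (hμ : μ ≠ 0) (h1 : -x * d * u = μ * (x - c₀) * Q)
    (h2 : μ * d * u - 2 * x * u = μ * (Q + (x - c₀) * Q')) :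
    2 / d = μ / x + 1 / (x - c₀) + Q' / Q := by
  have hc' := sub_ne_zero.2 hc
  field_simp
  refine mul_left_cancel₀ hμ ?_
  linear_combination (μ * d - 2 * x) * h1 + x * d * h2

/-- The value 2N + 2 is what the quadratic colours pass on to the chain of linear ones below. -/
theorem IsExplicitPair.logDeriv {n r : ℕ} {L : ℕ → ℕ} {s g : ℂ} {p q : ℕ → ℂ}
    (H : IsExplicitPair n r L s g p q) (hnr : n + 1 < r) (hL : 1 ≤ L (n + 1)) (hs : s ≠ 0) :
    s ^ 2 - p (n + 1) * s + q (n + 1) ≠ 0 ∧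
      (2 * s - p (n + 1)) / (s ^ 2 - p (n + 1) * s + q (n + 1)) * s =
        2 * shiftedSum L (n + 1) r + 2 := by
  have hD := one_sub_rootSum_add_ne_zero (r := r) hL (le_refl n) (by omega)
  have hI := two_sub_rootSum (rootProduct L (n + 1) r (n + 1))
    (two_mul_natCast_add_one_ne_zero (shiftedSum L (n + 1) r))
  rw [H.sum n le_rfl (by omega), H.prod n le_rfl (by omega), reflectedRoot_self]
  set R := rootSum (shiftedSum L (n + 1) r) (rootProduct L (n + 1) r (n + 1))
  set Y : ℂ := (rootProduct L (n + 1) r (n + 1) : ℂ)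
  have e1 : s ^ 2 - s * R * s + s ^ 2 * Y = s ^ 2 * (1 - R + Y) := by ring
  have e2 : 2 * s - s * R = s * (2 - R) := by ring
  rw [e1, e2]
  refine ⟨mul_ne_zero (pow_ne_zero 2 hs) hD, ?_⟩
  rw [hI]
  field_simp

/-- The formulas give the reflection identities back. Evaluated at roots of y_{k+1} or of y_{k+2},
these yield the two logarithmic derivatives whose combination is the Bethe equation, once all
denominators are known not to vanish. -/
theorem IsExplicitPair.pairEquations {n r : ℕ} {L : ℕ → ℕ} {s g : ℂ} {p q : ℕ → ℂ}
    (H : IsExplicitPair n r L s g p q) (hnr : n + 1 < r) (hL : 1 ≤ L (n + 1)) (hs : s ≠ 0)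
    (hp : p r = 2 * g) (hq : q r = g ^ 2) : PairEquations n r L s g p q := by
  have hN := two_mul_natCast_add_one_ne_zero (shiftedSum L (n + 1) r)
  have hN1 : (shiftedSum L (n + 1) r : ℂ) + 1 ≠ 0 := Nat.cast_add_one_ne_zero _
  set c : ℕ → ℂ := reflectedRoot L s n r with hcdef
  have hc0 : ∀ k, n ≤ k → k ≤ r → c k ≠ 0 := fun k h1 h2 => reflectedRoot_ne_zero hL hs h1 h2
  have hR : ∀ k, n ≤ k → k + 1 < r → IsReflection (shiftedSum L (n + 1) (k + 1)) (c k) (c (k + 1))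
      (p (k + 1)) (q (k + 1)) (p (k + 2)) (q (k + 2)) := by
    intro k hnk hkr
    obtain ⟨-, f1, f2, f3, f4⟩ := shiftedSum_facts (r := r) hL hnk (by omega)
    rw [H.sum (k + 1) (by omega) (by omega), H.prod (k + 1) (by omega) (by omega),
      isReflection_iff (w := weightRatio (shiftedSum L (n + 1) (k + 1)))
        f1 f2 hN f3 (hc0 k hnk (by omega)) f4 (by unfold rootRatio; push_cast; rfl)
        (by unfold weightRatio; push_cast; rfl) (reflectedRoot_succ L s r hnk),
      H.sum k hnk (by omega), H.prod k hnk (by omega),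
      rootProduct_eq L _ (by omega : k + 1 < r)]
    push_cast
    exact ⟨rfl, rfl⟩
  have hev : ∀ k, n ≤ k → k + 1 ≤ r → c k ^ 2 - p (k + 1) * c k + q (k + 1) ≠ 0 := by
    intro k hnk hkr
    rw [H.sum k hnk hkr, H.prod k hnk hkr]
    have := mul_ne_zero (pow_ne_zero 2 (hc0 k hnk (by omega)))
      (one_sub_rootSum_add_ne_zero hL hnk hkr)
    intro h
    exact this (by rw [← h]; ring)
  have hx0 : ∀ k, n ≤ k → k + 1 ≤ r → ∀ x, x ^ 2 - p (k + 1) * x + q (k + 1) = 0 → x ≠ 0 := by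
    rintro k hnk hkr x hx rfl
    have h1 : q (k + 1) = 0 := by linear_combination hx
    rw [H.prod k hnk hkr] at h1
    have h2 := (rootProduct_mem hL (by omega : n + 1 ≤ k + 1) hkr).1.ne'
    exact mul_ne_zero (pow_ne_zero 2 (hc0 k hnk (by omega))) (by exact_mod_cast h2) h1
  have hsimple : ∀ k, n ≤ k → k + 1 < r → ∀ x, x ^ 2 - p (k + 1) * x + q (k + 1) = 0 →
      2 * x - p (k + 1) ≠ 0 := by
    intro k hnk hkr x hx h0
    have h1 : p (k + 1) ^ 2 - 4 * q (k + 1) = 0 := by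
      linear_combination (2 * x - p (k + 1)) * h0 - 4 * hx
    rw [H.sum k hnk hkr.le, H.prod k hnk hkr.le] at h1
    have h2 := discrim_rootSum (rootProduct L (n + 1) r (k + 1)) hN hN1
    obtain ⟨-, h3, h4⟩ := rootProduct_mem hL (by omega : n + 1 ≤ k + 1) hkr.le
    have h5 : (rootProduct L (n + 1) r (k + 1) : ℂ) - 1 ≠ 0 :=
      sub_ne_zero.2 (by exact_mod_cast h3.ne)
    have h6 : (rootProduct L (n + 1) r (k + 1) : ℂ) -
        (shiftedSum L (n + 1) r / (shiftedSum L (n + 1) r + 1)) ^ 2 ≠ 0 := by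
      have := Complex.ofReal_injective.ne (h4 hkr).ne
      unfold weightRatio at this
      push_cast at this
      exact sub_ne_zero.2 this
    have h7 : ((2 * shiftedSum L (n + 1) r + 2 : ℂ) / (2 * shiftedSum L (n + 1) r + 1)) ^ 2 ≠ 0 :=
      pow_ne_zero 2 (div_ne_zero (fun h => hN1 (by linear_combination h / 2)) hN)
    have h8 := mul_ne_zero (pow_ne_zero 2 (hc0 k hnk (by omega)))
      (mul_ne_zero (mul_ne_zero h7 h5) h6)
    rw [← h2] at h8
    exact h8 (by rw [← h1]; ring)
  -- At a common root the identity reduces to x y'(x) (x - c) = 0, and each factor has been shown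
  -- not to vanish.
  have hcop : ∀ k, n ≤ k → k + 1 < r → ∀ x, x ^ 2 - p (k + 1) * x + q (k + 1) = 0 →
      x ^ 2 - p (k + 2) * x + q (k + 2) ≠ 0 := by
    intro k hnk hkr x hx hx'
    have h1 := (hR k hnk hkr).eval x
    rw [hx, hx'] at h1
    have h2 : x * (2 * x - p (k + 1)) * (x - c (k + 1)) = 0 := by linear_combination -h1
    rcases mul_eq_zero.1 h2 with h3 | h3
    · exact mul_ne_zero (hx0 k hnk hkr.le x hx) (hsimple k hnk hkr x hx) h3
    · rw [sub_eq_zero.1 h3] at hx'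
      exact hev (k + 1) (by omega) (by omega) hx'
  have hne : ∀ k, n ≤ k → k + 1 ≤ r → ∀ x, x ^ 2 - p (k + 1) * x + q (k + 1) = 0 → x ≠ c k := by
    rintro k hnk hkr x hx rfl
    exact hev k hnk hkr hx
  have hlog : ∀ k, n ≤ k → k + 1 < r → ∀ x, x ^ 2 - p (k + 1) * x + q (k + 1) = 0 →
      2 / (2 * x - p (k + 1)) = shiftedSum L (n + 1) (k + 1) / x + 1 / (x - c k) +
      (2 * x - p (k + 2)) / (x ^ 2 - p (k + 2) * x + q (k + 2)) := by
    intro k hnk hkr x hx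
    have h1 := (hR k hnk hkr).eval x
    have h2 := (hR k hnk hkr).eval_derivative x
    rw [hx] at h1 h2
    exact logDeriv_eq_of_reflection_at_root (u := x - c (k + 1)) (hx0 k hnk hkr.le x hx)
      (hne k hnk hkr.le x hx) (hcop k hnk hkr x hx) (hsimple k hnk hkr x hx)
      (shiftedSum_facts (r := r) hL hnk hkr.le).2.1 (by linear_combination h1)
      (by linear_combination h2)
  have hprev : ∀ k, n ≤ k → k + 2 ≤ r → ∀ x, x ^ 2 - p (k + 2) * x + q (k + 2) = 0 →
      x ^ 2 - p (k + 1) * x + q (k + 1) ≠ 0 ∧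
      (2 * x - p (k + 1)) / (x ^ 2 - p (k + 1) * x + q (k + 1)) =
        (shiftedSum L (n + 1) (k + 1) + 1) / x + 1 / (x - c (k + 1)) := by
    intro k hnk hkr x hx
    have h1 : x ^ 2 - p (k + 1) * x + q (k + 1) ≠ 0 := fun h => hcop k hnk hkr x h hx
    have h2 := (hR k hnk hkr).eval x
    rw [hx, mul_zero] at h2
    exact ⟨h1, logDeriv_eq_of_reflection (hx0 (k + 1) (by omega) hkr x hx)
      (hne (k + 1) (by omega) hkr x hx) h1 h2⟩
  refine ⟨fun x hx => ?_, fun k hnk hkr x hx => ?_, fun k hk => ?_⟩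
  · have h1 := hne n le_rfl hnr.le x hx
    have h2 := hlog n le_rfl hnr x hx
    rw [hcdef, reflectedRoot_self] at h1 h2
    rw [shiftedSum_self] at h2
    exact ⟨fun _ => hx0 n le_rfl hnr.le x hx, h1, hcop n le_rfl hnr x hx,
      hsimple n le_rfl hnr x hx, h2⟩
  · obtain ⟨j, rfl⟩ : ∃ j, k = j + 1 := ⟨k - 1, by omega⟩
    obtain ⟨h1, h2⟩ := hprev j (by omega) (by omega) x hx
    refine ⟨fun _ => hx0 (j + 1) (by omega) (by omega) x hx, h1,
      hcop (j + 1) (by omega) hkr x hx, hsimple (j + 1) (by omega) hkr x hx, ?_⟩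
    rw [h2, hlog (j + 1) (by omega) hkr x hx, shiftedSum_succ L (by omega : n + 1 ≤ j + 1)]
    push_cast
    ring
  · obtain ⟨j, rfl⟩ : ∃ j, k = j + 1 := ⟨k - 1, by omega⟩
    subst hk
    have hroot : g ^ 2 - p (j + 2) * g + q (j + 2) = 0 := by
      rw [show j + 2 = j + 1 + 1 from rfl, hp, hq]
      ring
    obtain ⟨h1, h2⟩ := hprev j (by omega) le_rfl g hroot
    have hg0 := hx0 (j + 1) (by omega) le_rfl g hroot
    refine ⟨fun _ => hg0, h1, ?_⟩
    rw [h2]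
    have hgc := H.last
    rw [reflectedRoot_succ L s _ (by omega : n ≤ j + 1), rootRatio_self] at hgc
    unfold weightRatio at hgc
    push_cast at hgc
    rw [← hcdef] at hgc
    have h3 := sub_ne_zero.2 (hne (j + 1) (by omega) le_rfl g hroot)
    have h4 : g + (shiftedSum L (n + 1) (j + 1 + 1)) * (g - c (j + 1)) = 0 := by
      rw [hgc]
      field_simp
      ring
    rw [shiftedSum_succ L (by omega : n + 1 ≤ j + 1)] at h4
    push_cast at h4
    field_simp
    linear_combination -h4

/-! ### Chains of linear polynomials -/

theorem shiftedSum_eq_add (L : ℕ → ℕ) {i n : ℕ} (h : i < n) :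
    shiftedSum L i n = L i + shiftedSum L (i + 1) n + 1 := by
  unfold shiftedSum
  rw [← Finset.insert_Icc_add_one_left_eq_Icc h.le, Finset.sum_insert (by simp)]
  omega

/-- The Bethe ansatz equation for roots `s k` of the colors `1 ≤ k ≤ n`, where `E` is the
contribution of the color `n + 1` to the equation of color `n`. -/
def ChainEquations (n : ℕ) (L : ℕ → ℕ) (s : ℕ → ℂ) (E : ℂ) : Prop :=
  ∀ k, k + 1 ≤ n → (L (k + 1) ≠ 0 → s (k + 1) ≠ 0) ∧ s (k + 1) ≠ s k ∧
    0 = L (k + 1) / s (k + 1) + 1 / (s (k + 1) - s k) +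
      if k + 1 = n then E else 1 / (s (k + 1) - s (k + 2))

/-- The explicit roots of a chain. -/
def IsExplicitChain (n : ℕ) (L : ℕ → ℕ) (s : ℕ → ℂ) (e : ℕ) : Prop :=
  ∀ k, k + 1 ≤ n → 1 ≤ shiftedSum L (k + 1) n + e ∧
    s (k + 1) = (shiftedSum L (k + 1) n + e : ℕ) / ((shiftedSum L (k + 1) n + e : ℕ) + 1) * s k

/-- The equation becomes T(b - a) + b = 0 with T = lam + S; T is positive because b is nonzero. The
last conclusion is the hypothesis on `E` for the previous colour, with T + 1 in place of S. -/
theorem chain_step {lam S : ℕ} {a b E : ℂ} (hb : b ≠ 0) (hab : b ≠ a) (hE : E * b = S)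
    (h : 0 = lam / b + 1 / (b - a) + E) :
    1 ≤ lam + S ∧ b = (lam + S : ℕ) / ((lam + S : ℕ) + 1) * a ∧ a ≠ 0 ∧
      1 / (a - b) * a = (lam + S : ℕ) + 1 := by
  have hd : b - a ≠ 0 := sub_ne_zero.2 hab
  have hd' : a - b ≠ 0 := sub_ne_zero.2 hab.symm
  have h1 : ((lam + S : ℕ) : ℂ) * (b - a) + b = 0 := by
    push_cast
    rw [← hE]
    field_simp at h
    linear_combination -h
  have h2 := Nat.cast_add_one_ne_zero (R := ℂ) (lam + S)
  generalize lam + S = T at *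
  refine ⟨?_, ?_, ?_, ?_⟩
  · rcases Nat.eq_zero_or_pos T with rfl | h
    · exact absurd (by simpa using h1) hb
    · exact h
  · field_simp
    linear_combination h1
  · rintro rfl
    exact mul_ne_zero h2 hb (by linear_combination h1)
  · field_simp
    linear_combination h1

theorem ChainEquations.isExplicitChain {n : ℕ} {L : ℕ → ℕ} {s : ℕ → ℂ} {E : ℂ} {e : ℕ}
    (H : ChainEquations n L s E) (hs : s n ≠ 0) (hE : E * s n = e) :
    IsExplicitChain n L s e := by
  have key : ∀ k, k ≤ n → s k ≠ 0 ∧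
      (k < n → 1 ≤ shiftedSum L (k + 1) n + e ∧ s (k + 1) =
        (shiftedSum L (k + 1) n + e : ℕ) / ((shiftedSum L (k + 1) n + e : ℕ) + 1) * s k ∧
        1 / (s k - s (k + 1)) * s k = (shiftedSum L (k + 1) n + e : ℕ) + 1) := by
    intro k hk
    induction hk using Nat.decreasingInduction with
    | self => exact ⟨hs, fun h => absurd h (lt_irrefl _)⟩
    | of_succ k hk ih =>
      obtain ⟨h1, h2⟩ := ih
      obtain ⟨h3, h4, h5⟩ := H k hk
      by_cases hkn : k + 1 = n
      · rw [if_pos hkn] at h5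
        have h6 := chain_step (S := e) h1 h4 (by rw [hkn, hE]) h5
        rw [hkn, shiftedSum_self]
        rw [hkn] at h6
        exact ⟨h6.2.2.1, fun _ => ⟨h6.1, h6.2.1, h6.2.2.2⟩⟩
      · rw [if_neg hkn] at h5
        have h7 := (h2 (by omega)).2.2
        have h6 := chain_step (S := shiftedSum L (k + 2) n + e + 1) h1 h4
          (by rw [h7]; push_cast; ring) h5
        have e1 : shiftedSum L (k + 1) n + e = L (k + 1) + (shiftedSum L (k + 2) n + e + 1) := by
          rw [shiftedSum_eq_add L (by omega : k + 1 < n)]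
          ring
        rw [← e1] at h6
        exact ⟨h6.2.2.1, fun _ => ⟨h6.1, h6.2.1, h6.2.2.2⟩⟩
  exact fun k hk => ⟨((key k (by omega)).2 hk).1, ((key k (by omega)).2 hk).2.1⟩

theorem IsExplicitChain.ne_zero {n : ℕ} {L : ℕ → ℕ} {s : ℕ → ℂ} {e : ℕ}
    (H : IsExplicitChain n L s e) (h0 : s 0 = 1) : ∀ k, k ≤ n → s k ≠ 0 := by
  intro k
  induction k with
  | zero => simp [h0]
  | succ k ih =>
    intro hk
    obtain ⟨h1, h2⟩ := H k hk
    rw [h2]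
    exact mul_ne_zero (div_ne_zero (Nat.cast_ne_zero.2 (by omega)) (Nat.cast_add_one_ne_zero _))
      (ih (by omega))

theorem IsExplicitChain.chainEquations {n : ℕ} {L : ℕ → ℕ} {s : ℕ → ℂ} {E : ℂ} {e : ℕ}
    (H : IsExplicitChain n L s e) (h0 : s 0 = 1) (hE : E * s n = e) :
    ChainEquations n L s E := by
  have hs := H.ne_zero h0
  have hmul : ∀ k, k + 1 ≤ n →
      ((shiftedSum L (k + 1) n + e : ℕ) : ℂ) * (s (k + 1) - s k) + s (k + 1) = 0 := by
    intro k hk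
    have h1 := (H k hk).2
    have h2 := Nat.cast_add_one_ne_zero (R := ℂ) (shiftedSum L (k + 1) n + e)
    rw [h1]
    field_simp
    ring
  have hne : ∀ k, k + 1 ≤ n → s (k + 1) ≠ s k := by
    intro k hk h
    have h1 := hmul k hk
    rw [h, sub_self, mul_zero, zero_add] at h1
    exact hs k (by omega) h1
  intro k hk
  refine ⟨fun _ => hs _ hk, hne k hk, ?_⟩
  have h1 := hmul k hk
  have h2 := hs _ hk
  have h3 := sub_ne_zero.2 (hne k hk)
  by_cases hkn : k + 1 = n
  · rw [if_pos hkn]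
    have h4 : E * s (k + 1) = e := by rw [hkn, hE]
    rw [← hkn, shiftedSum_self] at h1
    push_cast at h1
    field_simp
    linear_combination -h1 - (s (k + 1) - s k) * h4
  · rw [if_neg hkn]
    have h4 := hmul (k + 1) (by omega)
    have h5 := sub_ne_zero.2 (hne (k + 1) (by omega)).symm
    rw [shiftedSum_eq_add L (by omega : k + 1 < n)] at h1
    push_cast at h1 h4
    simp only [show k + 1 + 1 = k + 2 from rfl] at h4 h5
    have h6 : 1 / (s (k + 1) - s (k + 2)) =
        (shiftedSum L (k + 2) n + e + 1) / s (k + 1) := by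
      field_simp
      linear_combination h4
    rw [h6]
    field_simp
    linear_combination -h1

theorem IsExplicitChain.eq_prod {n : ℕ} {L : ℕ → ℕ} {s : ℕ → ℂ} {e : ℕ}
    (H : IsExplicitChain n L s e) (h0 : s 0 = 1) : ∀ k, k ≤ n → s k = ∏ i ∈ Finset.Icc 1 k,
      ((shiftedSum L i n + e : ℕ) : ℂ) / ((shiftedSum L i n + e : ℕ) + 1) := by
  intro k
  induction k with
  | zero => simp [h0]
  | succ k ih =>
    intro hk
    rw [(H k hk).2, ih (by omega), Finset.prod_Icc_succ_top (by omega), mul_comm]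

/-- Positivity needs checking only at the top colour: below it, `shiftedSum` contains a summand 1.
-/
theorem isExplicitChain_iff {n : ℕ} {L : ℕ → ℕ} {s : ℕ → ℂ} {e : ℕ} (h0 : s 0 = 1)
    (htop : 1 ≤ n → 1 ≤ L n + e) : IsExplicitChain n L s e ↔
      ∀ k, k ≤ n → s k = ∏ i ∈ Finset.Icc 1 k,
        ((shiftedSum L i n + e : ℕ) : ℂ) / ((shiftedSum L i n + e : ℕ) + 1) := by
  refine ⟨fun H => H.eq_prod h0, fun H k hk => ⟨?_, ?_⟩⟩
  · rcases hk.lt_or_eq with h | h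
    · rw [shiftedSum_eq_add L h]
      omega
    · rw [h, shiftedSum_self]
      exact htop (by omega)
  · rw [H (k + 1) hk, H k (by omega), Finset.prod_Icc_succ_top (by omega), mul_comm]

/-! ### Critical tuples of the three shapes -/

theorem critical_chain_iff {n r : ℕ} (hn : n < r) {L : ℕ → ℕ} {y : ℕ → ℂ[X]} {s : ℕ → ℂ}
    (hy : ∀ k, k ≤ n → y k = X - C (s k)) (hnext : 1 ≤ n → (y (n + 1)).eval (s n) ≠ 0) :
    (∀ k, 1 ≤ k → k ≤ n → ∀ x, (y k).eval x = 0 →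
      IsCriticalAt (L k) (nextMult r k) (y (k - 1)) (y k) (y (k + 1)) x) ↔
      ChainEquations n L s
        (nextMult r n * ((y (n + 1)).derivative.eval (s n) / (y (n + 1)).eval (s n))) := by
  have hterm : ∀ k, k + 1 ≤ n → nextMult r (k + 1) * ((y (k + 2)).derivative.eval (s (k + 1)) /
      (y (k + 2)).eval (s (k + 1))) = if k + 1 = n then
        nextMult r n * ((y (n + 1)).derivative.eval (s n) / (y (n + 1)).eval (s n))
        else 1 / (s (k + 1) - s (k + 2)) := by
    intro k hk
    by_cases hkn : k + 1 = n
    · rw [if_pos hkn, ← hkn]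
    · rw [if_neg hkn, hy (k + 2) (by omega), nextMult, if_neg (by omega)]
      simp
  constructor
  · intro H k hk
    have h1 := H (k + 1) (by omega) hk (s (k + 1)) (by rw [hy _ hk]; simp)
    have h2 := h1.prev
    have h3 := h1.eqn
    rw [hterm k hk, Nat.add_sub_cancel, hy k (by omega), hy _ hk] at h3
    rw [Nat.add_sub_cancel, hy k (by omega)] at h2
    refine ⟨fun h => h1.ne_zero (by exact_mod_cast h), ?_, ?_⟩
    · simpa [sub_ne_zero] using h2
    · simpa using h3
  · intro H k hk1 hk x hx
    obtain ⟨k, rfl⟩ : ∃ j, k = j + 1 := ⟨k - 1, by omega⟩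
    rw [hy _ hk] at hx
    obtain rfl : x = s (k + 1) := by simpa [sub_eq_zero] using hx
    obtain ⟨h1, h2, h3⟩ := H k hk
    refine ⟨fun h => h1 (by exact_mod_cast h), ?_, ?_, ?_, ?_⟩
    · rw [Nat.add_sub_cancel, hy k (by omega)]
      simpa [sub_ne_zero] using h2
    · by_cases hkn : k + 1 = n
      · rw [hkn]
        exact hnext (by omega)
      · rw [hy _ (by omega)]
        have := (H (k + 1) (by omega)).2.1
        simpa [sub_ne_zero] using this.symm
    · rw [hy _ hk]
      simp
    · rw [show k + 1 + 1 = k + 2 from rfl, hterm k hk, Nat.add_sub_cancel, hy k (by omega), hy _ hk]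
      simpa using h3

/-- The Bethe ansatz equation for the tuple `y` with weights `L`. -/
def IsCritical (r : ℕ) (L : ℕ → ℕ) (y : ℕ → ℂ[X]) : Prop :=
  ∀ k, 1 ≤ k → k ≤ r → ∀ x, (y k).eval x = 0 →
    IsCriticalAt (L k) (nextMult r k) (y (k - 1)) (y k) (y (k + 1)) x

theorem isCritical_iff_of_one {n r : ℕ} (hn : n < r) {L : ℕ → ℕ} {y : ℕ → ℂ[X]} {s : ℕ → ℂ}
    (h0 : s 0 = 1) (hy : ∀ k, k ≤ n → y k = X - C (s k)) (hy' : ∀ k, n < k → y k = 1) :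
    IsCritical r L y ↔ (1 ≤ n → 1 ≤ L n) ∧ IsExplicitChain n L s 0 := by
  have h1 : IsCritical r L y ↔ ChainEquations n L s 0 := by
    have h2 := critical_chain_iff hn (L := L) hy (by simp [hy' (n + 1) (by omega)])
    rw [hy' (n + 1) (by omega)] at h2
    simp only [derivative_one, eval_zero, zero_div, mul_zero] at h2
    rw [← h2]
    refine ⟨fun H k hk hkn => H k hk (by omega), fun H k hk hkr x hx => ?_⟩
    by_cases hkn : k ≤ n
    · exact H k hk hkn x hx
    · rw [hy' k (by omega)] at hx
      simp at hx
  rw [h1]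
  constructor
  · intro H
    -- With weight 0 and no next colour, the last equation would read 1/(s_n - s_{n-1}) = 0.
    have hL : 1 ≤ n → L n ≠ 0 := by
      intro hn1 hL
      obtain ⟨k, rfl⟩ : ∃ j, n = j + 1 := ⟨n - 1, by omega⟩
      obtain ⟨-, h3, h4⟩ := H k le_rfl
      rw [if_pos rfl, hL] at h4
      have h5 := sub_ne_zero.2 h3
      simp at h4
      exact h5 h4.symm
    refine ⟨fun h => Nat.one_le_iff_ne_zero.2 (hL h), H.isExplicitChain ?_ (by simp)⟩
    rcases Nat.eq_zero_or_pos n with rfl | hpos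
    · simp [h0]
    · obtain ⟨k, rfl⟩ : ∃ j, n = j + 1 := ⟨n - 1, by omega⟩
      exact (H k le_rfl).1 (hL (by omega))
  · rintro ⟨-, H⟩
    exact H.chainEquations h0 (by simp)

/-- Colour r is solved by itself. Its contribution to colour r - 1 counts twice because of the
double link, whence the starting value 2(λ_r + 1). -/
theorem isCritical_iff_of_full {n : ℕ} {L : ℕ → ℕ} {y : ℕ → ℂ[X]} {s : ℕ → ℂ}
    (h0 : s 0 = 1) (hy : ∀ k, k ≤ n + 1 → y k = X - C (s k)) (hy' : y (n + 2) = 1) :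
    IsCritical (n + 1) L y ↔ 1 ≤ L (n + 1) ∧ IsExplicitChain n L s (2 * L (n + 1) + 2) ∧
      s (n + 1) = L (n + 1) / (L (n + 1) + 1) * s n := by
  have hE : nextMult (n + 1) n * ((y (n + 1)).derivative.eval (s n) / (y (n + 1)).eval (s n)) =
      2 / (s n - s (n + 1)) := by
    rw [hy _ le_rfl, nextMult, if_pos rfl]
    simp
    ring
  have hsplit : IsCritical (n + 1) L y ↔ (∀ k, 1 ≤ k → k ≤ n → ∀ x, (y k).eval x = 0 →
      IsCriticalAt (L k) (nextMult (n + 1) k) (y (k - 1)) (y k) (y (k + 1)) x) ∧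
      (L (n + 1) ≠ 0 → s (n + 1) ≠ 0) ∧ s (n + 1) ≠ s n ∧
      0 = L (n + 1) / s (n + 1) + 1 / (s (n + 1) - s n) := by
    constructor
    · intro H
      refine ⟨fun k h1 h2 => H k h1 (by omega), ?_⟩
      have h1 := H (n + 1) (by omega) le_rfl (s (n + 1)) (by rw [hy _ le_rfl]; simp)
      have h2 := h1.prev
      have h3 := h1.eqn
      rw [show n + 1 + 1 = n + 2 from rfl, Nat.add_sub_cancel, hy n (by omega), hy _ le_rfl,
        hy'] at h3
      rw [Nat.add_sub_cancel, hy n (by omega)] at h2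
      refine ⟨fun h => h1.ne_zero (by exact_mod_cast h), ?_, ?_⟩
      · simpa [sub_ne_zero] using h2
      · simpa using h3
    · rintro ⟨H, h1, h2, h3⟩ k hk1 hk x hx
      rcases hk.lt_or_eq with hlt | rfl
      · exact H k hk1 (by omega) x hx
      · rw [hy _ le_rfl] at hx
        obtain rfl : x = s (n + 1) := by simpa [sub_eq_zero] using hx
        refine ⟨fun h => h1 (by exact_mod_cast h), ?_, ?_, ?_, ?_⟩
        · rw [Nat.add_sub_cancel, hy n (by omega)]
          simpa [sub_ne_zero] using h2
        · rw [show n + 1 + 1 = n + 2 from rfl, hy']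
          simp
        · rw [hy _ le_rfl]
          simp
        · rw [show n + 1 + 1 = n + 2 from rfl, Nat.add_sub_cancel, hy n (by omega), hy _ le_rfl,
            hy']
          simpa using h3
  have hnext : s (n + 1) ≠ s n → (1 ≤ n → (y (n + 1)).eval (s n) ≠ 0) := by
    intro h _
    rw [hy _ le_rfl]
    simpa [sub_ne_zero] using h.symm
  rw [hsplit]
  constructor
  · rintro ⟨H, h1, h2, h3⟩
    have hL : L (n + 1) ≠ 0 := by
      intro hL
      rw [hL] at h3
      have h5 := sub_ne_zero.2 h2
      simp at h3
      exact h5 h3.symm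
    obtain ⟨-, h4, h5, h6⟩ := chain_step (lam := L (n + 1)) (S := 0) (E := 0) (h1 hL) h2 (by simp)
      (by rw [add_zero]; exact h3)
    rw [add_zero] at h4 h6
    rw [critical_chain_iff (by omega) (fun k hk => hy k (by omega)) (hnext h2), hE] at H
    refine ⟨Nat.one_le_iff_ne_zero.2 hL, H.isExplicitChain h5 ?_, h4⟩
    push_cast
    linear_combination 2 * h6
  · rintro ⟨hL, H, h4⟩
    have hsn := H.ne_zero h0 n le_rfl
    have hL0 : (L (n + 1) : ℂ) ≠ 0 := Nat.cast_ne_zero.2 (by omega)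
    have hL1 := Nat.cast_add_one_ne_zero (R := ℂ) (L (n + 1))
    have h5 : L (n + 1) * (s (n + 1) - s n) + s (n + 1) = 0 := by
      rw [h4]
      field_simp
      ring
    have h6 : s (n + 1) ≠ 0 := by
      rw [h4]
      exact mul_ne_zero (div_ne_zero hL0 hL1) hsn
    have h7 : s (n + 1) ≠ s n := by
      intro h
      rw [h, sub_self, mul_zero, zero_add] at h5
      exact hsn h5
    have h8 := sub_ne_zero.2 h7
    have h8' := sub_ne_zero.2 h7.symm
    refine ⟨?_, fun _ => h6, h7, ?_⟩
    · rw [critical_chain_iff (by omega) (fun k hk => hy k (by omega)) (hnext h7), hE]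
      refine H.chainEquations h0 ?_
      push_cast
      field_simp
      linear_combination h5
    · field_simp
      linear_combination -h5

theorem isCritical_iff_of_pair {n r : ℕ} (hnr : n + 1 < r) {L : ℕ → ℕ} {y : ℕ → ℂ[X]}
    {s p q : ℕ → ℂ} {g : ℂ} (h0 : s 0 = 1) (hy : ∀ k, k ≤ n → y k = X - C (s k))
    (hy' : IsPairTuple n r y (s n) g p q) :
    IsCritical r L y ↔ 1 ≤ L (n + 1) ∧
      IsExplicitChain n L s (2 * shiftedSum L (n + 1) r + 2) ∧
      IsExplicitPair n r L (s n) g p q := by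
  have hsplit : IsCritical r L y ↔ (∀ k, 1 ≤ k → k ≤ n → ∀ x, (y k).eval x = 0 →
      IsCriticalAt (L k) (nextMult r k) (y (k - 1)) (y k) (y (k + 1)) x) ∧
      PairEquations n r L (s n) g p q := by
    rw [← hy'.critical_iff hnr]
    refine ⟨fun H => ⟨fun k h1 h2 => H k h1 (by omega), fun k h1 h2 => H k (by omega) h2⟩, ?_⟩
    rintro ⟨H1, H2⟩ k hk hkr
    by_cases hkn : k ≤ n
    · exact H1 k hk hkn
    · exact H2 k (by omega) hkr
  have hE := hy'.next_iff (k := n) (by omega) (by omega) (s n)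
  rw [hsplit]
  constructor
  · rintro ⟨H1, H2⟩
    have hL := H2.one_le
    obtain ⟨hs, hx⟩ := H2.isExplicitPair hnr hy'.p_last hy'.q_last
    have hlog := hx.logDeriv hnr hL hs
    have hne := hE.1.2 hlog.1
    rw [critical_chain_iff (by omega) hy fun _ => hne, hE.2 hne] at H1
    refine ⟨hL, H1.isExplicitChain hs ?_, hx⟩
    rw [hlog.2]
    push_cast
    ring
  · rintro ⟨hL, H1, hx⟩
    have hs := H1.ne_zero h0 n le_rfl
    have hlog := hx.logDeriv hnr hL hs
    have hne := hE.1.2 hlog.1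
    refine ⟨?_, hx.pairEquations hnr hL hs hy'.p_last hy'.q_last⟩
    rw [critical_chain_iff (by omega) hy fun _ => hne, hE.2 hne]
    refine H1.chainEquations h0 ?_
    rw [hlog.2]
    push_cast
    ring

/-! ### The explicit formulas -/

section Formulas

variable {r : ℕ} {la : Fin r → ℂ} {L : ℕ → ℕ}

theorem partialSum_eq (hL : ∀ i, coord la i = L i) (a b : ℕ) :
    partialSum la a b = (∑ i ∈ Finset.Icc a b, L i : ℕ) := by
  simp [partialSum, hL]

theorem cast_shiftedSum (hL : ∀ i, coord la i = L i) {a b : ℕ} (h : a ≤ b) :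
    (shiftedSum L a b : ℂ) = partialSum la a b + b - a := by
  rw [partialSum_eq hL, shiftedSum, Nat.cast_add, Nat.cast_sub h]
  ring

theorem cSmall_eq (hL : ∀ i, coord la i = L i) {l j : ℕ} (hj : j ≤ l) :
    cSmall la l j = ∏ i ∈ Finset.Icc 1 j,
      ((shiftedSum L i l + 0 : ℕ) : ℂ) / ((shiftedSum L i l + 0 : ℕ) + 1) := by
  refine Finset.prod_congr rfl fun i hi => ?_
  have hi' := Finset.mem_Icc.1 hi
  rw [add_zero, cast_shiftedSum hL (by omega)]

theorem prodMiddle_eq {n : ℕ} {la : Fin (n + 1) → ℂ} (hL : ∀ i, coord la i = L i) {j : ℕ}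
    (hj : j ≤ n) : prodMiddle la j = ∏ i ∈ Finset.Icc 1 j,
      ((shiftedSum L i n + (2 * L (n + 1) + 2) : ℕ) : ℂ) /
        ((shiftedSum L i n + (2 * L (n + 1) + 2) : ℕ) + 1) := by
  refine Finset.prod_congr rfl fun i hi => ?_
  have hi' := Finset.mem_Icc.1 hi
  push_cast
  rw [cast_shiftedSum hL (by omega), ← hL]
  congr 1 <;> ring

/-- For l = 2r - (n+1) one has m = n + 1, and l + 1 - i = (n - i) + 2(r - n - 1) + 2 splits into the
shifts of the two sums and the constant 2. -/
theorem cLarge_eq (hL : ∀ i, coord la i = L i) {n j : ℕ} (hn : n + 1 < r) (hj : j ≤ n) :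
    cLarge la (2 * r - (n + 1)) j = ∏ i ∈ Finset.Icc 1 j,
      ((shiftedSum L i n + (2 * shiftedSum L (n + 1) r + 2) : ℕ) : ℂ) /
        ((shiftedSum L i n + (2 * shiftedSum L (n + 1) r + 2) : ℕ) + 1) := by
  have h1 : 2 * r - (2 * r - (n + 1)) = n + 1 := by omega
  refine Finset.prod_congr rfl fun i hi => ?_
  have hi' := Finset.mem_Icc.1 hi
  rw [h1, Nat.add_sub_cancel, Nat.cast_sub (by omega)]
  push_cast
  rw [cast_shiftedSum hL (by omega), cast_shiftedSum hL hn.le]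
  push_cast
  congr 1 <;> ring

theorem partialSum_add (a : ℕ) {b c : ℕ} (la : Fin r → ℂ) (hab : a ≤ b + 1) (hbc : b ≤ c) :
    partialSum la a b + partialSum la (b + 1) c = partialSum la a c := by
  unfold partialSum
  rw [← Finset.sum_union]
  · congr 1
    ext i
    simp only [Finset.mem_union, Finset.mem_Icc]
    omega
  · rw [Finset.disjoint_left]
    intro i hi hi'
    simp only [Finset.mem_Icc] at hi hi'
    omega

/-- The numerator is 2N - μ_i: doubling the sum up to r and subtracting the one up to i leaves the
coordinates after i counted twice. -/
theorem prodLarge_eq (hL : ∀ i, coord la i = L i) {n a b : ℕ} (hn : n + 1 < r)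
    (ha : n + 1 ≤ a) (hb : b ≤ r) : prodLarge la (2 * r - (n + 1)) a b =
      ∏ i ∈ Finset.Icc a b,
        (rootRatio (shiftedSum L (n + 1) r) (shiftedSum L (n + 1) i) : ℂ) := by
  have h1 : 2 * r - (2 * r - (n + 1)) = n + 1 := by omega
  refine Finset.prod_congr rfl fun i hi => ?_
  have hi' := Finset.mem_Icc.1 hi
  rw [h1, Nat.cast_sub (by omega), rootRatio]
  push_cast
  rw [cast_shiftedSum hL (by omega : n + 1 ≤ i), cast_shiftedSum hL hn.le,
    ← partialSum_add (n + 1) la (by omega : n + 1 ≤ i + 1) (by omega : i ≤ r)]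
  push_cast
  congr 1 <;> ring

theorem prod_weightRatio_eq (hL : ∀ i, coord la i = L i) {n k : ℕ} (hn : n + 1 < r)
    (hk : n + 1 ≤ k) : ∏ i ∈ Finset.Icc k r,
      (partialSum la (n + 1) i + (2 * r - (n + 1) : ℕ) + i - 2 * r) /
        (partialSum la (n + 1) i + (2 * r - (n + 1) : ℕ) + i + 1 - 2 * r) =
      ∏ i ∈ Finset.Icc k r, (weightRatio (shiftedSum L (n + 1) i) : ℂ) := by
  refine Finset.prod_congr rfl fun i hi => ?_
  have hi' := Finset.mem_Icc.1 hi
  rw [Nat.cast_sub (by omega), weightRatio]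
  push_cast
  rw [cast_shiftedSum hL (by omega)]
  push_cast
  congr 1 <;> ring

theorem prod_weightRatio_reflect {f : ℕ → ℂ} {k : ℕ} (hk : k ≤ r) :
    ∏ i ∈ Finset.Icc 1 (r + 1 - k), f (r + 1 - i) = ∏ i ∈ Finset.Icc k r, f i := by
  refine Finset.prod_bij' (fun i _ => r + 1 - i) (fun i _ => r + 1 - i) ?_ ?_ ?_ ?_ ?_
  all_goals
    intro i hi
    have := Finset.mem_Icc.1 hi
    try rw [Finset.mem_Icc]
    try omega
  rfl

theorem rootProduct_eq_prod (n k : ℕ) : (rootProduct L (n + 1) r k : ℂ) =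
    (∏ i ∈ Finset.Icc k r, (rootRatio (shiftedSum L (n + 1) r) (shiftedSum L (n + 1) i) : ℂ)) *
      ∏ i ∈ Finset.Icc k r, (weightRatio (shiftedSum L (n + 1) i) : ℂ) := by
  unfold rootProduct
  push_cast
  exact Finset.prod_mul_distrib

theorem reflectedRoot_eq (hL : ∀ i, coord la i = L i) {n k : ℕ} (hn : n + 1 < r) (hk : k ≤ r) :
    cLarge la (2 * r - (n + 1)) n * prodLarge la (2 * r - (n + 1)) (n + 1) k =
      reflectedRoot L (cLarge la (2 * r - (n + 1)) n) n r k := by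
  rw [prodLarge_eq hL hn le_rfl hk, reflectedRoot]
  congr 2
  ext i
  simp only [Finset.mem_Icc, Finset.mem_Ioc]
  omega

theorem cLast_eq (hL : ∀ i, coord la i = L i) {n : ℕ} (hn : n + 1 < r) :
    cLast la (2 * r - (n + 1)) =
      reflectedRoot L (cLarge la (2 * r - (n + 1)) n) n r r := by
  have h1 : 2 * r - (2 * r - (n + 1)) = n + 1 := by omega
  rw [cLast, h1, Nat.add_sub_cancel, reflectedRoot_eq hL hn le_rfl]

theorem abSum_eq (hL : ∀ i, coord la i = L i) {n k : ℕ} (hn : n + 1 < r) (hk : n ≤ k)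
    (hkr : k + 1 ≤ r) : abSum la (2 * r - (n + 1)) (k + 1) =
      reflectedRoot L (cLarge la (2 * r - (n + 1)) n) n r k *
        rootSum (shiftedSum L (n + 1) r) (rootProduct L (n + 1) r (k + 1)) := by
  have h1 : 2 * r - (2 * r - (n + 1)) = n + 1 := by omega
  rw [abSum, h1, Nat.add_sub_cancel, Nat.add_sub_cancel, reflectedRoot_eq hL hn (by omega),
    prod_weightRatio_eq hL hn (by omega), prodLarge_eq hL hn (by omega) le_rfl,
    rootProduct_eq_prod, rootSum, Nat.cast_sub (by omega), cast_shiftedSum hL hn.le]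
  push_cast
  have e1 : 2 * partialSum la (n + 1) r + 2 * (2 * r - (n + 1)) - 2 * r =
    2 * (partialSum la (n + 1) r + r - (n + 1)) := by ring
  have e2 : 2 * partialSum la (n + 1) r + 2 * (2 * r - (n + 1)) + 1 - 2 * r =
    2 * (partialSum la (n + 1) r + r - (n + 1)) + 1 := by ring
  have e3 : 2 * partialSum la (n + 1) r + 2 * (2 * r - (n + 1)) + 2 - 2 * r =
    2 * (partialSum la (n + 1) r + r - (n + 1)) + 2 := by ring
  rw [e1, e2, e3]
  ring

theorem abProd_eq (hL : ∀ i, coord la i = L i) {n k : ℕ} (hn : n + 1 < r) (hk : n ≤ k)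
    (hkr : k + 1 ≤ r) : abProd la (2 * r - (n + 1)) (k + 1) =
      reflectedRoot L (cLarge la (2 * r - (n + 1)) n) n r k ^ 2 *
        rootProduct L (n + 1) r (k + 1) := by
  have h1 : 2 * r - (2 * r - (n + 1)) = n + 1 := by omega
  have h2 : ∏ i ∈ Finset.Icc 1 (r + 1 - (k + 1)),
      (partialSum la (n + 1) (r + 1 - i) + (2 * r - (n + 1) : ℕ) + 1 - i - r) /
        (partialSum la (n + 1) (r + 1 - i) + (2 * r - (n + 1) : ℕ) + 2 - i - r) =
      ∏ i ∈ Finset.Icc (k + 1) r, (weightRatio (shiftedSum L (n + 1) i) : ℂ) := by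
    rw [← prod_weightRatio_eq hL hn (by omega), ← prod_weightRatio_reflect hkr]
    refine Finset.prod_congr rfl fun i hi => ?_
    have hi' := Finset.mem_Icc.1 hi
    rw [Nat.cast_sub (by omega : i ≤ r + 1)]
    push_cast
    congr 1 <;> ring
  have h3 : prodLarge la (2 * r - (n + 1)) (n + 1) r = prodLarge la (2 * r - (n + 1)) (n + 1) k *
      ∏ i ∈ Finset.Icc (k + 1) r,
        (rootRatio (shiftedSum L (n + 1) r) (shiftedSum L (n + 1) i) : ℂ) := by
    rw [prodLarge_eq hL hn le_rfl le_rfl, prodLarge_eq hL hn le_rfl (by omega),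
      ← Finset.prod_union]
    · congr 1
      ext i
      simp only [Finset.mem_union, Finset.mem_Icc]
      omega
    · rw [Finset.disjoint_left]
      intro i hi hi'
      simp only [Finset.mem_Icc] at hi hi'
      omega
  rw [abProd, h1, Nat.add_sub_cancel, Nat.add_sub_cancel, h2, h3,
    ← reflectedRoot_eq hL hn (by omega), rootProduct_eq_prod]
  ring

theorem quadratic_injective {p q p' q' : ℂ}
    (h : (X ^ 2 - C p * X + C q : ℂ[X]) = X ^ 2 - C p' * X + C q') : p = p' ∧ q = q' := by
  have h0 := congrArg (eval 0) h
  have h1 := congrArg (eval 1) h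
  simp at h0 h1
  exact ⟨by linear_combination -h1 + h0, h0⟩

theorem X_sub_C_injective {a b : ℂ} (h : (X - C a : ℂ[X]) = X - C b) : a = b := by
  have h0 := congrArg (eval 0) h
  simpa using h0

/-- The Bethe ansatz equation for `l = (1, …, 1, 0, …, 0)` with less than `r` ones. -/
theorem isCritical_iff_explicit_of_one (hL : ∀ i, coord la i = L i) {n : ℕ} (hn : n < r)
    {y : ℕ → ℂ[X]} (h0 : y 0 = X - C 1) (hy : ∀ k, 1 ≤ k → k ≤ n → ∃ c, y k = X - C c)
    (hy' : ∀ k, n < k → y k = 1) : IsCritical r L y ↔ (1 ≤ n → 1 ≤ L n) ∧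
      ∀ k, 1 ≤ k → k ≤ r → y k = explicitPoly la n k := by
  have hs : ∀ k, ∃ c, k ≤ n → y k = X - C c := by
    intro k
    by_cases hk : 1 ≤ k ∧ k ≤ n
    · obtain ⟨c, hc⟩ := hy k hk.1 hk.2
      exact ⟨c, fun _ => hc⟩
    · refine ⟨1, fun h => ?_⟩
      obtain rfl : k = 0 := by omega
      exact h0
  choose s hs using hs
  have hs0 : s 0 = 1 := X_sub_C_injective ((hs 0 (Nat.zero_le _)).symm.trans h0)
  rw [isCritical_iff_of_one hn hs0 hs hy']
  refine and_congr_right fun htop => ?_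
  rw [isExplicitChain_iff hs0 (fun h => by simpa using htop h)]
  constructor
  · intro H k hk hkr
    rw [explicitPoly, if_pos hn]
    by_cases hkn : k ≤ n
    · rw [if_pos hkn, hs k hkn, H k hkn, cSmall_eq hL hkn]
    · rw [if_neg hkn, hy' k (by omega)]
  · intro H k hk
    rcases Nat.eq_zero_or_pos k with rfl | hpos
    · simp [hs0]
    · have h1 := H k hpos (by omega)
      rw [explicitPoly, if_pos hn, if_pos hk, hs k hk] at h1
      rw [X_sub_C_injective h1, cSmall_eq hL hk]

/-- The Bethe ansatz equation for `l = (1, …, 1)`. -/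
theorem isCritical_iff_explicit_of_full {n : ℕ} {la : Fin (n + 1) → ℂ}
    (hL : ∀ i, coord la i = L i) {y : ℕ → ℂ[X]} (h0 : y 0 = X - C 1)
    (hy : ∀ k, 1 ≤ k → k ≤ n + 1 → ∃ c, y k = X - C c) (hy' : y (n + 2) = 1) :
    IsCritical (n + 1) L y ↔ 1 ≤ L (n + 1) ∧
      ∀ k, 1 ≤ k → k ≤ n + 1 → y k = explicitPoly la (n + 1) k := by
  have hs : ∀ k, ∃ c, k ≤ n + 1 → y k = X - C c := by
    intro k
    by_cases hk : 1 ≤ k ∧ k ≤ n + 1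
    · obtain ⟨c, hc⟩ := hy k hk.1 hk.2
      exact ⟨c, fun _ => hc⟩
    · refine ⟨1, fun h => ?_⟩
      obtain rfl : k = 0 := by omega
      exact h0
  choose s hs using hs
  have hs0 : s 0 = 1 := X_sub_C_injective ((hs 0 (Nat.zero_le _)).symm.trans h0)
  rw [isCritical_iff_of_full hs0 hs hy']
  refine and_congr_right fun htop => ?_
  rw [isExplicitChain_iff hs0 (fun h => by omega)]
  have hexp : ∀ k, explicitPoly la (n + 1) k = X - C (cMiddle la k) := by
    intro k
    rw [explicitPoly, if_neg (lt_irrefl _), if_pos rfl]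
  constructor
  · rintro ⟨H, H'⟩ k hk hkr
    rw [hs k hkr, hexp, cMiddle]
    split_ifs with hkn
    · subst hkn
      rw [H', H n le_rfl, hL, Nat.add_sub_cancel, prodMiddle_eq hL le_rfl]
    · rw [H k (by omega), prodMiddle_eq hL (by omega)]
  · intro H
    have H1 : ∀ k, k ≤ n → s k = prodMiddle la k := by
      intro k hk
      rcases Nat.eq_zero_or_pos k with rfl | hpos
      · simp [hs0, prodMiddle]
      · have h1 := H k hpos (by omega)
        rw [hs k (by omega), hexp, cMiddle, if_neg (by omega)] at h1
        exact X_sub_C_injective h1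
    refine ⟨fun k hk => by rw [H1 k hk, prodMiddle_eq hL hk], ?_⟩
    have h1 := H (n + 1) (by omega) le_rfl
    rw [hs _ le_rfl, hexp, cMiddle, if_pos rfl, hL, Nat.add_sub_cancel, ← H1 n le_rfl] at h1
    exact X_sub_C_injective h1

/-- The Bethe ansatz equation for `l = (1, …, 1, 2, …, 2, 1)` with `n` leading ones. -/
theorem isCritical_iff_explicit_of_pair (hL : ∀ i, coord la i = L i) {n : ℕ} (hn : n + 1 < r)
    {y : ℕ → ℂ[X]} (h0 : y 0 = X - C 1) (hy : ∀ k, 1 ≤ k → k ≤ n → ∃ c, y k = X - C c)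
    (hyp : ∀ k, n < k → k < r → ∃ p q, y k = X ^ 2 - C p * X + C q)
    (hyr : ∃ c, y r = X - C c) (hy' : y (r + 1) = 1) : IsCritical r L y ↔ 1 ≤ L (n + 1) ∧
      ∀ k, 1 ≤ k → k ≤ r → y k = explicitPoly la (2 * r - (n + 1)) k := by
  have hs : ∀ k, ∃ c, k ≤ n → y k = X - C c := by
    intro k
    by_cases hk : 1 ≤ k ∧ k ≤ n
    · obtain ⟨c, hc⟩ := hy k hk.1 hk.2
      exact ⟨c, fun _ => hc⟩
    · refine ⟨1, fun h => ?_⟩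
      obtain rfl : k = 0 := by omega
      exact h0
  choose s hs using hs
  have hs0 : s 0 = 1 := X_sub_C_injective ((hs 0 (Nat.zero_le _)).symm.trans h0)
  obtain ⟨g, hg⟩ := hyr
  have hpq : ∀ k, ∃ p q, (n < k → k < r → y k = X ^ 2 - C p * X + C q) ∧
      (k = r → p = 2 * g ∧ q = g ^ 2) := by
    intro k
    by_cases hk : n < k ∧ k < r
    · obtain ⟨p, q, h⟩ := hyp k hk.1 hk.2
      exact ⟨p, q, fun _ _ => h, fun h => absurd h (by omega)⟩
    -- At k = r the coefficients are those of (x - g)², although y_r itself is linear.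
    · exact ⟨2 * g, g ^ 2, fun h1 h2 => absurd ⟨h1, h2⟩ hk, fun _ => ⟨rfl, rfl⟩⟩
  choose p q hpq using hpq
  have hpt : IsPairTuple n r y (s n) g p q :=
    ⟨hs n le_rfl, fun k => (hpq k).1, hg, hy', ((hpq r).2 rfl).1, ((hpq r).2 rfl).2⟩
  rw [isCritical_iff_of_pair hn hs0 hs hpt]
  refine and_congr_right fun htop => ?_
  rw [isExplicitChain_iff hs0 (fun h => by omega)]
  have h1 : 2 * r - (2 * r - (n + 1)) = n + 1 := by omega
  have hexp : ∀ k, explicitPoly la (2 * r - (n + 1)) k =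
      if k = r then X - C (cLast la (2 * r - (n + 1))) else if k < n + 1 then
        X - C (cLarge la (2 * r - (n + 1)) k) else X ^ 2 - C (abSum la (2 * r - (n + 1)) k) * X +
          C (abProd la (2 * r - (n + 1)) k) := by
    intro k
    rw [explicitPoly, if_neg (by omega), if_neg (by omega), h1]
  constructor
  · rintro ⟨H, H'⟩ k hk hkr
    have hsn : s n = cLarge la (2 * r - (n + 1)) n := by rw [H n le_rfl, cLarge_eq hL hn le_rfl]
    rw [hexp]
    split_ifs with hkr' hkn
    · rw [hkr', hg, H'.last, hsn, cLast_eq hL hn]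
    · rw [hs k (by omega), H k (by omega), cLarge_eq hL hn (by omega)]
    · obtain ⟨j, rfl⟩ : ∃ j, k = j + 1 := ⟨k - 1, by omega⟩
      rw [(hpq _).1 (by omega) (by omega), H'.sum j (by omega) hkr, H'.prod j (by omega) hkr,
        abSum_eq hL hn (by omega) hkr, abProd_eq hL hn (by omega) hkr, hsn]
  · intro H
    have H1 : ∀ k, k ≤ n → s k = cLarge la (2 * r - (n + 1)) k := by
      intro k hk
      rcases Nat.eq_zero_or_pos k with rfl | hpos
      · simp [hs0, cLarge]
      · have h1 := H k hpos (by omega)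
        rw [hs k (by omega), hexp, if_neg (by omega), if_pos (by omega)] at h1
        exact X_sub_C_injective h1
    have hg' : g = reflectedRoot L (s n) n r r := by
      have h2 := H r (by omega) le_rfl
      rw [hg, hexp, if_pos rfl, cLast_eq hL hn, ← H1 n le_rfl] at h2
      exact X_sub_C_injective h2
    refine ⟨fun k hk => by rw [H1 k hk, cLarge_eq hL hn hk], ?_⟩
    have H2 : ∀ k, n ≤ k → k + 1 ≤ r → p (k + 1) = reflectedRoot L (s n) n r k *
        rootSum (shiftedSum L (n + 1) r) (rootProduct L (n + 1) r (k + 1)) ∧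
        q (k + 1) = reflectedRoot L (s n) n r k ^ 2 * rootProduct L (n + 1) r (k + 1) := by
      intro k hk hkr
      rcases hkr.lt_or_eq with hlt | rfl
      · have h2 := H (k + 1) (by omega) hkr
        rw [(hpq _).1 (by omega) hlt, hexp, if_neg (by omega), if_neg (by omega),
          abSum_eq hL hn hk hkr, abProd_eq hL hn hk hkr, ← H1 n le_rfl] at h2
        exact quadratic_injective h2
      -- The explicit tuple has no quadratic at colour r; the pair (2g, g²) is compared with
      -- `rootSum` at its double-root value.
      · have hN := two_mul_natCast_add_one_ne_zero (shiftedSum L (n + 1) (k + 1))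
        have hN1 := Nat.cast_add_one_ne_zero (R := ℂ) (shiftedSum L (n + 1) (k + 1))
        have h3 := rootSum_sq hN hN1
        rw [((hpq (k + 1)).2 rfl).1, ((hpq (k + 1)).2 rfl).2, hg', reflectedRoot_succ L _ _ hk,
          rootRatio_self, rootProduct_self, weightRatio]
        push_cast
        rw [h3]
        exact ⟨by ring, by ring⟩
    exact ⟨fun k h1 h2 => (H2 k h1 h2).1, fun k h1 h2 => (H2 k h1 h2).2, hg'⟩

end Formulas

/-! ### Admissibility -/

theorem exists_natCast_eq_intCast_iff (z : ℤ) : (∃ m : ℕ, (z : ℂ) = m) ↔ 0 ≤ z := by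
  constructor
  · rintro ⟨m, hm⟩
    have : z = m := by exact_mod_cast hm
    omega
  · intro h
    obtain ⟨m, rfl⟩ := Int.eq_ofNat_of_zero_le h
    exact ⟨m, by simp⟩

theorem isDominantIntegral_iff {r : ℕ} {la : Fin r → ℂ} {L : ℕ → ℕ} (hL : ∀ i, coord la i = L i)
    {l : Fin r → ℕ} {f : ℕ → ℤ} (hf : ∀ n, coord (fun i => (l i : ℂ)) n = f n) :
    IsDominantIntegral (la + omegaOne r - rootCombination (cartanC r) l) ↔
      ∀ i, i < r → 0 ≤ (L (i + 1) : ℤ) + (if i = 0 then 1 else 0) -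
        (2 * f (i + 1) - f i - (if i + 2 = r then 2 else 1) * f (i + 2)) := by
  have h : ∀ i : Fin r, (la + omegaOne r - rootCombination (cartanC r) l) i =
      (((L (i.val + 1) : ℤ) + (if i.val = 0 then 1 else 0) -
        (2 * f (i.val + 1) - f i.val - (if i.val + 2 = r then 2 else 1) * f (i.val + 2)) : ℤ) :
        ℂ) := by
    intro i
    have h1 := sum_cartanC_mul (fun j => (l j : ℂ)) i
    rw [hf, hf, hf] at h1
    have h2 : rootCombination (cartanC r) l i = ∑ j, (cartanC r i j : ℂ) * (l j : ℂ) :=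
      Finset.sum_congr rfl fun j _ => mul_comm _ _
    rw [Pi.sub_apply, Pi.add_apply, h2, h1, ← coord_succ la i, hL, omegaOne, nextMult]
    push_cast
    rfl
  unfold IsDominantIntegral
  constructor
  · intro H i hi
    have := H ⟨i, hi⟩
    rw [h, exists_natCast_eq_intCast_iff] at this
    exact this
  · intro H i
    rw [h, exists_natCast_eq_intCast_iff]
    exact H i i.isLt

theorem coord_tupleOne {r k : ℕ} (hk : k ≤ r) (n : ℕ) :
    coord (fun i => (tupleOne r k i : ℂ)) n = ((if 1 ≤ n ∧ n ≤ k then 1 else 0 : ℤ) : ℂ) := by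
  simp only [coord, tupleOne]
  split_ifs <;> first | omega | simp

theorem coord_tupleTwo {r k : ℕ} (hk : k + 2 ≤ r) (n : ℕ) :
    coord (fun i => (tupleTwo r k i : ℂ)) n =
      ((if n = 0 then 0 else if n ≤ k then 1 else if n < r then 2 else if n = r then 1 else 0 : ℤ) :
        ℂ) := by
  simp only [coord, tupleTwo]
  split_ifs <;> first | omega | simp

section

variable {r : ℕ} {la : Fin r → ℂ} {L : ℕ → ℕ}

theorem isAdmissible_tupleOne_iff (hr : 2 ≤ r) (hL : ∀ i, coord la i = L i) {k : ℕ}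
    (hk : k ≤ r) : IsAdmissible la (tupleOne r k) ↔ (1 ≤ k → 1 ≤ L k) := by
  have h : IsListed r (tupleOne r k) := Or.inl ⟨k, hk, rfl⟩
  rw [IsAdmissible, and_iff_right h, isDominantIntegral_iff hL (coord_tupleOne hk)]
  constructor
  · intro H hk1
    have := H (k - 1) (by omega)
    rw [Nat.sub_add_cancel hk1] at this
    split_ifs at this <;> omega
  · intro H i hi
    by_cases hik : i + 1 = k
    · have := H (by omega)
      rw [← hik] at this ⊢
      split_ifs <;> omega
    · split_ifs <;> omega

theorem isAdmissible_tupleTwo_iff (hL : ∀ i, coord la i = L i) {k : ℕ}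
    (hk : k + 2 ≤ r) : IsAdmissible la (tupleTwo r k) ↔ 1 ≤ L (k + 1) := by
  have h : IsListed r (tupleTwo r k) := Or.inr ⟨k, hk, rfl⟩
  rw [IsAdmissible, and_iff_right h, isDominantIntegral_iff hL (coord_tupleTwo hk)]
  -- In one-based indices the weight is λ + ω_k - ω_{k+1} with ω_0 = 0, so only the coordinate k + 1
  -- can become negative.
  have key : ∀ i, i < r → (L (i + 1) : ℤ) + (if i = 0 then 1 else 0) -
      (2 * (if i + 1 = 0 then 0 else if i + 1 ≤ k then 1 else if i + 1 < r then 2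
        else if i + 1 = r then 1 else 0) -
      (if i = 0 then 0 else if i ≤ k then 1 else if i < r then 2 else if i = r then 1 else 0) -
      (if i + 2 = r then 2 else 1) * (if i + 2 = 0 then 0 else if i + 2 ≤ k then 1
        else if i + 2 < r then 2 else if i + 2 = r then 1 else 0)) =
      L (i + 1) + (if i = k then -1 else if i + 1 = k then 1 else 0) := by
    intro i hi
    rw [if_neg (Nat.succ_ne_zero i), if_neg (Nat.succ_ne_zero (i + 1)), if_neg hi.ne]
    rcases Nat.lt_or_ge k i with hki | hki
    · rw [if_neg (by omega : ¬ i = 0), if_neg (by omega : ¬ i + 1 ≤ k),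
        if_neg (by omega : ¬ i ≤ k), if_neg (by omega : ¬ i + 2 ≤ k),
        if_neg (by omega : ¬ i = k), if_neg (by omega : ¬ i + 1 = k), if_pos hi]
      split_ifs <;> omega
    · rw [if_pos hki, if_pos (by omega : i + 1 < r)]
      split_ifs <;> omega
  constructor
  · intro H
    have := H k (by omega)
    rw [key k (by omega), if_pos rfl] at this
    omega
  · intro H i hi
    rw [key i hi]
    by_cases hik : i = k
    · rw [if_pos hik, hik]
      omega
    · rw [if_neg hik]
      split_ifs <;> omega

end

theorem sum_range_ite_lt {r k : ℕ} (hk : k ≤ r) :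
    ∑ i ∈ Finset.range r, (if i < k then 1 else 0) = k := by
  induction r, hk using Nat.le_induction with
  | base =>
    rw [Finset.sum_congr rfl fun i hi => if_pos (Finset.mem_range.1 hi)]
    simp
  | succ r hk ih => rw [Finset.sum_range_succ, ih, if_neg (by omega)]; omega

theorem sum_tupleOne {r k : ℕ} (hk : k ≤ r) : ∑ j, tupleOne r k j = k := by
  exact (Fin.sum_univ_eq_sum_range (fun i => if i < k then 1 else 0) r).trans
    (sum_range_ite_lt hk)

theorem sum_tupleTwo {r k : ℕ} (hk : k + 2 ≤ r) : ∑ j, tupleTwo r k j = 2 * r - (k + 1) := by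
  have h1 : ∑ j, tupleTwo r k j = ∑ i ∈ Finset.range r,
      (if i < k then 1 else if i + 1 < r then 2 else 1) :=
    Fin.sum_univ_eq_sum_range (fun i => if i < k then 1 else if i + 1 < r then 2 else 1) r
  have h2 := sum_range_ite_lt (by omega : k ≤ r)
  have h3 := sum_range_ite_lt (by omega : r - 1 ≤ r)
  -- Adding the indicator of i < k to the tuple gives 1 plus the indicator of i < r - 1, and both
  -- indicators have known sums.
  have h4 : ∑ i ∈ Finset.range r, (if i < k then 1 else if i + 1 < r then 2 else 1) +
      ∑ i ∈ Finset.range r, (if i < k then 1 else 0) =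
      ∑ i ∈ Finset.range r, (if i < r - 1 then 1 else 0) + r := by
    have h5 : ∑ i ∈ Finset.range r, 1 = r := by simp
    have h6 : ∑ i ∈ Finset.range r, (if i < r - 1 then 1 else 0) + r =
        ∑ i ∈ Finset.range r, ((if i < r - 1 then 1 else 0) + 1) := by
      rw [Finset.sum_add_distrib, h5]
    rw [← Finset.sum_add_distrib, h6]
    refine Finset.sum_congr rfl fun i hi => ?_
    have := Finset.mem_range.1 hi
    split_ifs <;> omega
  omega

/-! ### The main theorem -/

theorem exists_prod_eq_of_one {n : ℕ} (hn : n = 1) (f : Fin n → ℂ) :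
    ∃ c, ∏ j, (X - C (f j)) = X - C c := by
  subst hn
  exact ⟨f 0, by simp⟩

theorem exists_prod_eq_of_two {n : ℕ} (hn : n = 2) (f : Fin n → ℂ) :
    ∃ p q, ∏ j, (X - C (f j)) = X ^ 2 - C p * X + C q := by
  subst hn
  refine ⟨f 0 + f 1, f 0 * f 1, ?_⟩
  rw [Fin.prod_univ_two, C_add, C_mul]
  ring

theorem prod_eq_of_zero {n : ℕ} (hn : n = 0) (f : Fin n → ℂ) : ∏ j, (X - C (f j)) = 1 := by
  subst hn
  simp

theorem extendedTuple_eq {r : ℕ} {l : Fin r → ℕ} (t : Var l → ℂ) {k : ℕ} (hk : 1 ≤ k)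
    (hkr : k ≤ r) : ∃ i : Fin r, i.val + 1 = k ∧ extendedTuple t k = representingTuple t i := by
  refine ⟨⟨k - 1, by omega⟩, by simp; omega, ?_⟩
  rw [extendedTuple, dif_pos ⟨hk, hkr⟩]

theorem forall_extendedTuple_iff {r : ℕ} {l : Fin r → ℕ} (t : Var l → ℂ) (y : ℕ → ℂ[X]) :
    (∀ k, 1 ≤ k → k ≤ r → extendedTuple t k = y k) ↔
      ∀ i : Fin r, representingTuple t i = y (i.val + 1) := by
  constructor
  · intro h i
    rw [← extendedTuple_succ]
    exact h _ (by omega) i.isLt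
  · intro h k hk hkr
    obtain ⟨i, rfl, hi⟩ := extendedTuple_eq t hk hkr
    rw [hi, h]

section

variable {r : ℕ} {la : Fin r → ℂ} {L : ℕ → ℕ}

theorem isBetheSolution_iff_isCritical (hL : ∀ i, coord la i = L i) {l : Fin r → ℕ}
    (t : Var l → ℂ) :
    IsBetheSolution (cartanC r) (symmetrizerC r) ![la, omegaOne r] ![0, 1] l t ↔
      IsCritical r L (extendedTuple t) := by
  rw [isBetheSolution_iff]
  simp only [hL]
  rfl

theorem isBetheSolution_iff_of_tupleOne (hr : 2 ≤ r) (hL : ∀ i, coord la i = L i) {k : ℕ}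
    (hk : k ≤ r) (t : Var (tupleOne r k) → ℂ) :
    IsBetheSolution (cartanC r) (symmetrizerC r) ![la, omegaOne r] ![0, 1] (tupleOne r k) t ↔
      IsAdmissible la (tupleOne r k) ∧
        ∀ i, representingTuple t i = explicitPoly la k (i.val + 1) := by
  have hy : ∀ j, 1 ≤ j → j ≤ k → ∃ c, extendedTuple t j = X - C c := by
    intro j hj hjk
    obtain ⟨i, hi, h⟩ := extendedTuple_eq t hj (by omega)
    rw [h]
    exact exists_prod_eq_of_one (if_pos (by omega)) _
  rw [isBetheSolution_iff_isCritical hL, isAdmissible_tupleOne_iff hr hL hk,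
    ← forall_extendedTuple_iff t]
  rcases hk.lt_or_eq with hlt | rfl
  · refine isCritical_iff_explicit_of_one hL hlt (extendedTuple_zero t) hy fun j hj => ?_
    by_cases hjr : j ≤ r
    · obtain ⟨i, hi, h⟩ := extendedTuple_eq t (by omega) hjr
      rw [h]
      exact prod_eq_of_zero (if_neg (by omega)) _
    · exact extendedTuple_of_lt t (by omega)
  · obtain ⟨n, rfl⟩ : ∃ n, k = n + 1 := ⟨k - 1, by omega⟩
    rw [isCritical_iff_explicit_of_full hL (extendedTuple_zero t) hy
      (extendedTuple_of_lt t (by omega))]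
    simp

theorem isBetheSolution_iff_of_tupleTwo (hL : ∀ i, coord la i = L i) {k : ℕ}
    (hk : k + 2 ≤ r) (t : Var (tupleTwo r k) → ℂ) :
    IsBetheSolution (cartanC r) (symmetrizerC r) ![la, omegaOne r] ![0, 1] (tupleTwo r k) t ↔
      IsAdmissible la (tupleTwo r k) ∧
        ∀ i, representingTuple t i = explicitPoly la (2 * r - (k + 1)) (i.val + 1) := by
  rw [isBetheSolution_iff_isCritical hL, isAdmissible_tupleTwo_iff hL hk,
    ← forall_extendedTuple_iff t]
  refine isCritical_iff_explicit_of_pair hL (by omega) (extendedTuple_zero t)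
    (fun j hj hjk => ?_) (fun j hj hjr => ?_) ?_ (extendedTuple_of_lt t (by omega))
  · obtain ⟨i, hi, h⟩ := extendedTuple_eq t hj (by omega)
    rw [h]
    exact exists_prod_eq_of_one (if_pos (by omega)) _
  · obtain ⟨i, hi, h⟩ := extendedTuple_eq t (by omega) hjr.le
    rw [h]
    refine exists_prod_eq_of_two ?_ _
    rw [tupleTwo, if_neg (by omega), if_pos (by omega)]
  · obtain ⟨i, hi, h⟩ := extendedTuple_eq t (by omega) (le_refl r)
    rw [h]
    refine exists_prod_eq_of_one ?_ _
    rw [tupleTwo, if_neg (by omega), if_neg (by omega)]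

theorem monic_quadratic (p q : ℂ) : (X ^ 2 - C p * X + C q : ℂ[X]).Monic ∧
    (X ^ 2 - C p * X + C q : ℂ[X]).natDegree = 2 := by
  have h : (X ^ 2 - C p * X + C q : ℂ[X]) = C 1 * X ^ 2 + C (-p) * X + C q := by
    rw [C_neg, C_1]
    ring
  rw [h]
  exact ⟨leadingCoeff_quadratic one_ne_zero, natDegree_quadratic one_ne_zero⟩

theorem explicitPoly_tupleOne (la : Fin r → ℂ) {k : ℕ} (hk : k ≤ r) (i : Fin r) :
    (explicitPoly la k (i.val + 1)).Monic ∧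
      (explicitPoly la k (i.val + 1)).natDegree = tupleOne r k i := by
  have hi := i.isLt
  rw [explicitPoly, tupleOne]
  by_cases h1 : k < r
  · rw [if_pos h1]
    by_cases h2 : i.val + 1 ≤ k
    · rw [if_pos h2, if_pos (by omega)]
      exact ⟨monic_X_sub_C _, natDegree_X_sub_C _⟩
    · rw [if_neg h2, if_neg (by omega)]
      exact ⟨monic_one, natDegree_one⟩
  · rw [if_neg h1, if_pos (by omega), if_pos (by omega)]
    exact ⟨monic_X_sub_C _, natDegree_X_sub_C _⟩

theorem explicitPoly_tupleTwo (la : Fin r → ℂ) {k : ℕ} (hk : k + 2 ≤ r) (i : Fin r) :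
    (explicitPoly la (2 * r - (k + 1)) (i.val + 1)).Monic ∧
      (explicitPoly la (2 * r - (k + 1)) (i.val + 1)).natDegree = tupleTwo r k i := by
  have hi := i.isLt
  have h1 : 2 * r - (2 * r - (k + 1)) = k + 1 := by omega
  rw [explicitPoly, if_neg (by omega), if_neg (by omega), h1, tupleTwo]
  rcases lt_trichotomy i.val k with h | h | h
  · rw [if_neg (by omega), if_pos (by omega), if_pos h]
    exact ⟨monic_X_sub_C _, natDegree_X_sub_C _⟩
  all_goals
    rw [if_neg (by omega : ¬ i.val < k)]
    by_cases hr : i.val + 1 = r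
    · rw [if_pos hr, if_neg (by omega)]
      exact ⟨monic_X_sub_C _, natDegree_X_sub_C _⟩
    · rw [if_neg hr, if_neg (by omega), if_pos (by omega)]
      exact monic_quadratic _ _

end

theorem IsBetheSolution.injective {r n : ℕ} {Λ : Fin n → Fin r → ℂ} {z : Fin n → ℂ}
    {l : Fin r → ℕ} {t : Var l → ℂ}
    (h : IsBetheSolution (cartanC r) (symmetrizerC r) Λ z l t) (i : Fin r) (j j' : Fin (l i))
    (hj : t ⟨i, j⟩ = t ⟨i, j'⟩) : j = j' := by
  by_contra hne
  refine h.2.1 ⟨i, j⟩ ⟨i, j'⟩ (fun h => hne ?_) ((rootPairing_ne_zero_iff _ _).2 (Or.inl rfl)) hj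
  simpa using h

end Gaudin

open Gaudin in
theorem mainTheorem6 (r : ℕ) (hr : 3 ≤ r) (la : Fin r → ℂ) (hla : Gaudin.IsDominantIntegral la)
    (l : Fin r → ℕ) (hl : Gaudin.IsListed r l) :
    (¬ Gaudin.IsAdmissible la l →
      ¬ ∃ t : Gaudin.Var l → ℂ, Gaudin.IsBetheSolution (Gaudin.cartanC r) (Gaudin.symmetrizerC r)
        ![la, Gaudin.omegaOne r] ![0, 1] l t) ∧
    (Gaudin.IsAdmissible la l →
      ∃ t : Gaudin.Var l → ℂ,
        Gaudin.IsBetheSolution (Gaudin.cartanC r) (Gaudin.symmetrizerC r)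
          ![la, Gaudin.omegaOne r] ![0, 1] l t ∧
        (∀ t' : Gaudin.Var l → ℂ,
          Gaudin.IsBetheSolution (Gaudin.cartanC r) (Gaudin.symmetrizerC r)
            ![la, Gaudin.omegaOne r] ![0, 1] l t' → Gaudin.SameOrbit t t') ∧
        ∀ i : Fin r,
          Gaudin.representingTuple t i = Gaudin.explicitPoly la (∑ j, l j) (i.val + 1)) := by
  have hL : ∃ L : ℕ → ℕ, ∀ i, coord la i = L i := by
    choose m hm using hla
    refine ⟨fun i => if h : 1 ≤ i ∧ i ≤ r then m ⟨i - 1, by omega⟩ else 0, fun i => ?_⟩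
    by_cases h : 1 ≤ i ∧ i ≤ r
    · simp only [coord, dif_pos h, hm]
    · simp only [coord, dif_neg h, Nat.cast_zero]
  obtain ⟨L, hL⟩ := hL
  have key : (∀ t : Var l → ℂ,
      IsBetheSolution (cartanC r) (symmetrizerC r) ![la, omegaOne r] ![0, 1] l t ↔
        IsAdmissible la l ∧
          ∀ i, representingTuple t i = explicitPoly la (∑ j, l j) (i.val + 1)) ∧
      ∀ i : Fin r, (explicitPoly la (∑ j, l j) (i.val + 1)).Monic ∧
        (explicitPoly la (∑ j, l j) (i.val + 1)).natDegree = l i := by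
    rcases hl with ⟨k, hk, rfl⟩ | ⟨k, hk, rfl⟩
    · rw [sum_tupleOne hk]
      exact ⟨isBetheSolution_iff_of_tupleOne (by omega) hL hk, explicitPoly_tupleOne la hk⟩
    · rw [sum_tupleTwo hk]
      exact ⟨isBetheSolution_iff_of_tupleTwo hL hk, explicitPoly_tupleTwo la hk⟩
  obtain ⟨key, hdeg⟩ := key
  refine ⟨fun h ⟨t, ht⟩ => h ((key t).1 ht).1, fun h => ?_⟩
  -- Over ℂ the explicit polynomials split and have the required degrees, so their roots supply the
  -- candidate `t`. Uniqueness follows because the polynomials are forced and have simple roots.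
  obtain ⟨t, ht⟩ := exists_representingTuple (fun i => explicitPoly la (∑ j, l j) (i.val + 1))
    (fun i => (hdeg i).1) fun i => (hdeg i).2
  refine ⟨t, (key t).2 ⟨h, ht⟩, fun t' ht' => ?_, ht⟩
  exact sameOrbit_of_representingTuple_eq ht'.injective fun i =>
    (ht i).trans (((key t').1 ht').2 i).symm
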